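/- Let $G$ be a finite group, $R$ a commutative ring, and $\alpha=(D_g,\alpha_g)_{g\in G}$ a unital partial action of $G$ on $R$: the ideals $D_g=R1_g$ are generated by idempotents $1_g$, the $\alpha_g:D_{g^{-1}}\to D_g$ are ring isomorphisms, $D_1=R$, $\alpha_1=\mathrm{id}_R$, and for all $g,h\in G$ one has $\alpha_h^{-1}(D_h\cap D_{g^{-1}})\subseteq D_{(gh)^{-1}}$ and $\alpha_g\circ\alpha_h=\alpha_{gh}$ on $\alpha_h^{-1}(D_h\cap D_{g^{-1}})$. Let $R^\alpha=\{r\in R:\alpha_g(r1_{g^{-1}})=r1_g\ \forall g\in G\}$, and assume that $R\supseteq R^\alpha$ is a partial Galois extension: there are $x_i,y_i\in R$, $1\le i\le m$, with $\sum_i x_i\alpha_g(y_i1_{g^{-1}})=\delta_{1,g}$ for all $g\in G$. An $R$-bimodule $P$ is partially invertible if it is finitely generated projective as a left and as a right $R$-module and the maps $R\to\mathrm{End}(P_R)$, $R\to\mathrm{End}({}_RP)$ given by multiplication are surjective. Let $\mathbf{PicS}(R)$ be the monoid of isomorphism classes $[P]$ of such bimodules under $\otimes_R$, and $\mathbf{PicS}_k(R)$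 the submonoid of the classes of those that are central over the subring $k\subseteq R$. Let $\Theta(g)=[(D_g)_{g^{-1}}]$, where $(D_g)_{g^{-1}}=D_g$ as a set with $r*d=rd$ and $d*r=d\,\alpha_g(r1_{g^{-1}})$. Let $\alpha^*$ be the partial action of $G$ on $\mathbf{PicS}_R(R)$ given by the ideals $\mathcal X_g=\mathbf{PicS}_R(R)[D_g]$ and the maps $\alpha^*_g:\mathcal X_{g^{-1}}\to\mathcal X_g$, $[P]\mapsto[P_g]$, where $P_g=P$ as a set, with the central action $r\bullet p=\alpha_{g^{-1}}(r1_g)p$. Let $Z^1(G,\alpha^*,\mathbf{PicS}_R(R))$ be the set of maps $f:G\to\mathbf{PicS}_R(R)$ such that $f(g)$ is invertible in the monoid $\mathcal X_g$ (with neutral element $[D_g]$) and $\alpha^*_g(f(h)[D_{g^{-1}}])f(g)=f(gh)[D_g]$ for all $g,h\in G$. A unital partial representation of $G$ with idempotents $1_g$ is a map $\Gamma:G\to\mathbf{PicS}(R)$, $g\mapsto[\Gamma_g]$, with $\Gamma(1)=[R]$, $\Gamma(g)\Gamma(h)\Gamma(h^{-1})=\Gamma(gh)\Gamma(h^{-1})$,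 $\Gamma(g^{-1})\Gamma(g)\Gamma(h)=\Gamma(g^{-1})\Gamma(gh)$ and $\Gamma(g)\Gamma(g^{-1})=[R1_g]$ for all $g,h\in G$. A factor set for it is a family of $R$-bimodule isomorphisms $f_{g,h}:\Gamma_g\otimes_R\Gamma_h\to1_g\Gamma_{gh}$ with $f_{gh,l}(f_{g,h}(x\otimes y)\otimes z)=f_{g,hl}(x\otimes f_{h,l}(y\otimes z))$ for all $g,h,l\in G$, $x\in\Gamma_g$, $y\in\Gamma_h$, $z\in\Gamma_l$. The associated partial generalized crossed product is $\Delta(\Gamma)=\bigoplus_{g\in G}\Gamma_g$ with the biadditive multiplication $x\circ y=f_{g,h}(x\otimes y)$ for $x\in\Gamma_g$, $y\in\Gamma_h$. **Theorem.** Let $A$ be an Azumaya $R^\alpha$-algebra containing $R$ as a maximal commutative subalgebra. For $g\in G$ let $$C_g=\{a\in1_{g^{-1}}A:\ \alpha_{g^{-1}}(r1_g)\,a=a\,r\ \ \forall r\in R\},$$ a central $R$-bimodule with $r\cdot a=\alpha_{g^{-1}}(r1_g)a=ar$. Let $f_A(g)=[C_g]$. Let $\Gamma_g$ be the set $C_g$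 with the $R$-actions $r\star a=ar$ and $a\star r=ra$. Then: 1. $f_A\in Z^1(G,\alpha^*,\mathbf{PicS}_R(R))$; 2. $[\Gamma_g]=f_A(g)\Theta(g)\in\mathbf{PicS}_{R^\alpha}(R)$ for all $g\in G$, and $\Gamma=f_A\Theta$ is a unital partial representation with idempotents $1_g$; 3. the maps $\Gamma_g\otimes_R\Gamma_h\to1_g\Gamma_{gh}$, $u\otimes v\mapsto vu$ (product in $A$), form a factor set for $\Gamma$; 4. for this factor set, $\Delta(\Gamma)\cong A^{\mathrm{op}}$ as $R^\alpha$-algebras. In particular every such algebra $A$ is a partial generalized crossed product: there are $f\in Z^1(G,\alpha^*,\mathbf{PicS}_R(R))$, a unital partial representation $\Gamma'=f\Theta$ with idempotents $1_g$ and a factor set for $\Gamma'$ such that $A\cong\Delta(\Gamma')$ as $R^\alpha$-algebras. -/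

import Mathlib

open scoped TensorProduct DirectSum
open MulOpposite

universe u v

/-! ### Bimodules over a commutative ring, their tensor product, and their isomorphism classes -/

/-- A (not necessarily central) bimodule over a commutative ring `R`: the left action is `r • x`,
the right action `x · r` is `op r • x`. -/
structure RBimodule (R : Type u) [CommRing R] : Type (u + 1) where
  carrier : Type u
  [addCommGroup : AddCommGroup carrier]
  [leftModule : Module R carrier]
  [rightModule : Module Rᵐᵒᵖ carrier]
  [smulComm : SMulCommClass R Rᵐᵒᵖ carrier]

namespace RBimodule

attribute [instance] addCommGroup leftModule rightModule smulComm

variable {R : Type u} [CommRing R]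

/-- A bimodule from two commuting actions of the commutative ring `R`: `r • x = l r x` and
`op r • x = ρ r x`. -/
@[reducible] def ofActions (M : Type u) [AddCommGroup M] (l ρ : R →+* AddMonoid.End M)
    (h : ∀ r s x, l r (ρ s x) = ρ s (l r x)) : RBimodule R :=
  letI lm : Module R M := Module.compHom M l
  letI rm : Module Rᵐᵒᵖ M := Module.compHom M (ρ.comp (RingEquiv.toOpposite R).symm.toRingHom)
  { carrier := M
    leftModule := lm
    rightModule := rm
    smulComm := ⟨fun r s x => h r (unop s) x⟩ }

/-- An `R`-module as a central `R`-bimodule. -/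
def central (M : Type u) [AddCommGroup M] [Module R M] : RBimodule R :=
  ofActions M (Module.toAddMonoidEnd R M) (Module.toAddMonoidEnd R M)
    (fun r s x => smul_comm r s x)

/-- Isomorphism of bimodules. -/
def Iso (M N : RBimodule R) : Prop :=
  ∃ e : M.carrier ≃ₗ[R] N.carrier, ∀ (r : R) (x : M.carrier), e (op r • x) = op r • e x

/-- The submodule of `M ⊗[ℤ] N` generated by the elements `(m · r) ⊗ n - m ⊗ (r • n)`. -/
def tensorRel (M N : RBimodule R) : Submodule R (M.carrier ⊗[ℤ] N.carrier) :=
  Submodule.span R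
    {t | ∃ (m : M.carrier) (r : R) (n : N.carrier),
      t = (op r • m) ⊗ₜ[ℤ] n - m ⊗ₜ[ℤ] (r • n)}

/-- Right multiplication by `r` on `M ⊗[ℤ] N`. -/
def rightMul (M N : RBimodule R) (r : Rᵐᵒᵖ) :
    M.carrier ⊗[ℤ] N.carrier →ₗ[R] M.carrier ⊗[ℤ] N.carrier :=
  TensorProduct.AlgebraTensorModule.map LinearMap.id
    (DistribSMul.toAddMonoidHom N.carrier r).toIntLinearMap

@[simp] lemma rightMul_tmul (M N : RBimodule R) (r : Rᵐᵒᵖ) (m : M.carrier) (n : N.carrier) :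
    rightMul M N r (m ⊗ₜ n) = m ⊗ₜ (r • n) := rfl

lemma rightMul_le (M N : RBimodule R) (r : Rᵐᵒᵖ) :
    tensorRel M N ≤ (tensorRel M N).comap (rightMul M N r) := by
  refine Submodule.span_le.2 ?_
  rintro _ ⟨m, s, n, rfl⟩
  refine Submodule.subset_span ⟨m, s, r • n, ?_⟩
  simp [smul_comm s r n]

/-- The right action of `R` on the quotient of `M ⊗[ℤ] N`, through `N`. -/
@[reducible] def tensorRightModule (M N : RBimodule R) :
    Module Rᵐᵒᵖ ((M.carrier ⊗[ℤ] N.carrier) ⧸ tensorRel M N) :=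
  { smul := fun r x => (tensorRel M N).mapQ (tensorRel M N) (rightMul M N r) (rightMul_le M N r) x
    one_smul := by
      intro x
      obtain ⟨x, rfl⟩ := Submodule.Quotient.mk_surjective _ x
      refine congrArg (Submodule.Quotient.mk (p := tensorRel M N)) ?_
      induction x with
      | zero => simp
      | tmul a b => simp
      | add a b ha hb => rw [map_add, ha, hb]
    mul_smul := by
      intro r s x
      obtain ⟨x, rfl⟩ := Submodule.Quotient.mk_surjective _ x
      refine congrArg (Submodule.Quotient.mk (p := tensorRel M N)) ?_
      induction x with
      | zero => simp
      | tmul a b => simp [mul_smul]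
      | add a b ha hb => simp only [map_add, ha, hb]
    smul_zero := fun r => map_zero _
    smul_add := fun r x y => map_add _ x y
    add_smul := by
      intro r s x
      obtain ⟨x, rfl⟩ := Submodule.Quotient.mk_surjective _ x
      refine congrArg (Submodule.Quotient.mk (p := tensorRel M N))
        (a₁ := rightMul M N (r + s) x) (a₂ := rightMul M N r x + rightMul M N s x) ?_
      induction x with
      | zero => simp
      | tmul a b => simp [add_smul, TensorProduct.tmul_add]
      | add a b ha hb => simp only [map_add, ha, hb]; abel
    zero_smul := by
      intro x
      obtain ⟨x, rfl⟩ := Submodule.Quotient.mk_surjective _ x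
      refine congrArg (Submodule.Quotient.mk (p := tensorRel M N))
        (a₁ := rightMul M N 0 x) (a₂ := 0) ?_
      induction x with
      | zero => simp
      | tmul a b => simp
      | add a b ha hb => rw [map_add, ha, hb, add_zero] }

/-- `M ⊗_R N`, with the left action of `M` and the right action of `N`. -/
def tensor (M N : RBimodule R) : RBimodule R :=
  letI := tensorRightModule M N
  { carrier := (M.carrier ⊗[ℤ] N.carrier) ⧸ tensorRel M N
    smulComm := ⟨fun r s x => (map_smul ((tensorRel M N).mapQ (tensorRel M N) (rightMul M N s)
      (rightMul_le M N s)) r x).symm⟩ }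

/-- The elementary tensor `m ⊗ n` in `M ⊗_R N`. -/
def tmul {M N : RBimodule R} (m : M.carrier) (n : N.carrier) : (tensor M N).carrier :=
  Submodule.Quotient.mk (p := tensorRel M N) (m ⊗ₜ[ℤ] n)

lemma smul_tmul {M N : RBimodule R} (r : R) (m : M.carrier) (n : N.carrier) :
    r • tmul m n = tmul (r • m) n := rfl

lemma op_smul_tmul {M N : RBimodule R} (r : R) (m : M.carrier) (n : N.carrier) :
    op r • tmul m n = tmul m (op r • n) := rfl

lemma op_smul_tmul_eq {M N : RBimodule R} (r : R) (m : M.carrier) (n : N.carrier) :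
    tmul (op r • m) n = tmul m (r • n) :=
  (Submodule.Quotient.eq _).2 (Submodule.subset_span ⟨m, r, n, rfl⟩)

/-- The left linear map `M ⊗_R N → P` given by a balanced biadditive map that is left linear in
the first variable. -/
def lift {M N P : RBimodule R} (b : M.carrier →+ N.carrier →+ P.carrier)
    (hl : ∀ (r : R) m n, b (r • m) n = r • b m n)
    (hb : ∀ (r : R) m n, b (op r • m) n = b m (r • n)) :
    (tensor M N).carrier →ₗ[R] P.carrier :=
  (tensorRel M N).liftQ
    (TensorProduct.AlgebraTensorModule.lift
      { toFun := fun m => (b m).toIntLinearMap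
        map_add' := fun m m' => by ext; simp
        map_smul' := fun r m => by ext n; simp [hl] })
    (by
      refine Submodule.span_le.2 ?_
      rintro _ ⟨m, r, n, rfl⟩
      simp [hb])

@[simp] lemma lift_tmul {M N P : RBimodule R} (b : M.carrier →+ N.carrier →+ P.carrier)
    (hl : ∀ (r : R) m n, b (r • m) n = r • b m n)
    (hb : ∀ (r : R) m n, b (op r • m) n = b m (r • n)) (m : M.carrier) (n : N.carrier) :
    lift b hl hb (tmul m n) = b m n := rfl

lemma Iso.refl (M : RBimodule R) : Iso M M := ⟨LinearEquiv.refl R _, fun _ _ => rfl⟩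

lemma Iso.symm {M N : RBimodule R} : Iso M N → Iso N M := by
  rintro ⟨e, he⟩
  refine ⟨e.symm, fun r x => ?_⟩
  rw [LinearEquiv.symm_apply_eq, he, e.apply_symm_apply]

lemma Iso.trans {M N P : RBimodule R} : Iso M N → Iso N P → Iso M P := by
  rintro ⟨e, he⟩ ⟨f, hf⟩
  exact ⟨e.trans f, fun r x => by simp [he, hf]⟩

lemma Iso.tensor {M M' N N' : RBimodule R} : Iso M M' → Iso N N' →
    Iso (M.tensor N) (M'.tensor N') := by
  rintro ⟨e, he⟩ ⟨f, hf⟩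
  have hf' : ∀ (r : R) x, f.symm (op r • x) = op r • f.symm x := fun r x => by
    rw [LinearEquiv.symm_apply_eq, hf, f.apply_symm_apply]
  have he' : ∀ (r : R) x, e.symm (op r • x) = op r • e.symm x := fun r x => by
    rw [LinearEquiv.symm_apply_eq, he, e.apply_symm_apply]
  let E : M.carrier ⊗[ℤ] N.carrier ≃ₗ[R] M'.carrier ⊗[ℤ] N'.carrier :=
    TensorProduct.AlgebraTensorModule.congr e f.toAddEquiv.toIntLinearEquiv
  have hE : (tensorRel M N).map (E : _ →ₗ[R] _) = tensorRel M' N' := by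
    apply le_antisymm
    · rw [Submodule.map_le_iff_le_comap]
      refine Submodule.span_le.2 ?_
      rintro _ ⟨m, r, n, rfl⟩
      refine Submodule.subset_span ⟨e m, r, f n, ?_⟩
      simp [E, he]
    · refine Submodule.span_le.2 ?_
      rintro _ ⟨m, r, n, rfl⟩
      refine ⟨_, Submodule.subset_span ⟨e.symm m, r, f.symm n, rfl⟩, ?_⟩
      simp [E, he]
  refine ⟨Submodule.Quotient.equiv _ _ E hE, fun r x => ?_⟩
  obtain ⟨x, rfl⟩ := Submodule.Quotient.mk_surjective _ x
  refine congrArg (Submodule.Quotient.mk (p := tensorRel M' N'))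
    (a₁ := E (rightMul M N (op r) x)) (a₂ := rightMul M' N' (op r) (E x)) ?_
  induction x with
  | zero => simp
  | tmul a b => simp [E, hf]
  | add a b ha hb => simp only [map_add, ha, hb]

/-- Isomorphism of bimodules as an equivalence relation. -/
instance setoid (R : Type u) [CommRing R] : Setoid (RBimodule R) where
  r := Iso
  iseqv := ⟨Iso.refl, Iso.symm, Iso.trans⟩

/-- `P` is partially invertible: finitely generated projective on both sides, and `R` maps onto the
endomorphisms of the right module `P` and onto those of the left module `P`. -/
def IsPartiallyInvertible (P : RBimodule R) : Prop :=
  Module.Finite R P.carrier ∧ Module.Projective R P.carrier ∧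
  Module.Finite Rᵐᵒᵖ P.carrier ∧ Module.Projective Rᵐᵒᵖ P.carrier ∧
  (∀ φ : P.carrier →ₗ[Rᵐᵒᵖ] P.carrier, ∃ r : R, ∀ p, φ p = r • p) ∧
  (∀ φ : P.carrier →ₗ[R] P.carrier, ∃ r : R, ∀ p, φ p = op r • p)

/-- `P` is central over the subring `k` of `R`. -/
def IsCentralOver (P : RBimodule R) (k : Subring R) : Prop :=
  ∀ c ∈ k, ∀ p : P.carrier, c • p = op c • p

end RBimodule

/-- Isomorphism classes of `R`-bimodules. -/
def BimodClass (R : Type u) [CommRing R] : Type (u + 1) := Quotient (RBimodule.setoid R)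

namespace BimodClass

variable {R : Type u} [CommRing R]

/-- The class `[P]`. -/
def mk (P : RBimodule R) : BimodClass R := Quotient.mk _ P

/-- `[P][Q] = [P ⊗_R Q]`. -/
instance : Mul (BimodClass R) :=
  ⟨Quotient.map₂ RBimodule.tensor fun _ _ h _ _ h' => RBimodule.Iso.tensor h h'⟩

/-- The neutral element `[R]`. -/
instance : One (BimodClass R) := ⟨mk (RBimodule.central R)⟩

/-- The class `[R e]` of the ideal `R e` as a central bimodule. -/
def ofIdem (e : R) : BimodClass R := mk (RBimodule.central (Ideal.span {e} : Ideal R))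

/-- `PicS(R)`. -/
def PicS (R : Type u) [CommRing R] : Set (BimodClass R) :=
  {x | ∃ P : RBimodule R, P.IsPartiallyInvertible ∧ mk P = x}

/-- `PicS_k(R)`, for a subring `k` of `R`; `PicS_R(R)` is the case `k = ⊤`. -/
def PicSOver (k : Subring R) : Set (BimodClass R) :=
  {x | ∃ P : RBimodule R, P.IsPartiallyInvertible ∧ P.IsCentralOver k ∧ mk P = x}

end BimodClass

/-! ### Partial representations, factor sets and partial generalized crossed products -/

/-- A partial representation of a group in a monoid. -/
structure IsPartialRep {G : Type v} [Group G] {S : Type*} [Mul S] [One S] (θ : G → S) : Prop where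
  map_one : θ 1 = 1
  mul_mul_inv : ∀ g h, θ g * θ h * θ h⁻¹ = θ (g * h) * θ h⁻¹
  inv_mul_mul : ∀ g h, θ g⁻¹ * θ g * θ h = θ g⁻¹ * θ (g * h)

section CrossedProduct

variable {G : Type v} [Group G] {R : Type u} [CommRing R]

/-- `g ↦ [Γ g]` is a unital partial representation of `G` in `PicS(R)`, with
`[Γ g][Γ g⁻¹] = [R e_g]` for the idempotents `e_g` of `R`. -/
structure IsUnitalPartialRep (e : G → R) (Γ : G → RBimodule R) : Prop where
  mem_picS : ∀ g, BimodClass.mk (Γ g) ∈ BimodClass.PicS R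
  partialRep : IsPartialRep fun g => BimodClass.mk (Γ g)
  idem : ∀ g, IsIdempotentElem (e g)
  mul_inv : ∀ g, BimodClass.mk (Γ g) * BimodClass.mk (Γ g⁻¹) = BimodClass.ofIdem (e g)

/-- A family of maps `f_{g,h} : Γ_g ⊗_R Γ_h → Γ_{gh}` is a factor set if every `f_{g,h}` is a
bimodule isomorphism onto the subbimodule `e_g Γ_{gh}`, and
`f_{gh,l} (f_{g,h}(x ⊗ y) ⊗ z) = f_{g,hl} (x ⊗ f_{h,l}(y ⊗ z))`; the two sides of the last equation
lie in `Γ_{(gh)l}` and `Γ_{g(hl)}`, so they are compared in the disjoint union of the `Γ_g`. -/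
structure IsFactorSet (e : G → R) (Γ : G → RBimodule R)
    (f : ∀ g h, ((Γ g).tensor (Γ h)).carrier →ₗ[R] (Γ (g * h)).carrier) : Prop where
  map_op_smul : ∀ g h (r : R) x, f g h (op r • x) = op r • f g h x
  injective : ∀ g h, Function.Injective (f g h)
  range_eq : ∀ g h, Set.range (f g h) = {y | ∃ z : (Γ (g * h)).carrier, e g • z = y}
  assoc : ∀ g h l (x : (Γ g).carrier) (y : (Γ h).carrier) (z : (Γ l).carrier),
    (⟨g * h * l, f (g * h) l (RBimodule.tmul (f g h (RBimodule.tmul x y)) z)⟩ :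
      Σ s : G, (Γ s).carrier) =
    ⟨g * (h * l), f g (h * l) (RBimodule.tmul x (f h l (RBimodule.tmul y z)))⟩

/-- The underlying set `⨁ g, Γ g` of the partial generalized crossed product `Δ(Γ)` of the
family `f`. -/
def CrossedProduct (Γ : G → RBimodule R)
    (_f : ∀ g h, ((Γ g).tensor (Γ h)).carrier →ₗ[R] (Γ (g * h)).carrier) : Type (max u v) :=
  ⨁ g, (Γ g).carrier

namespace CrossedProduct

variable (Γ : G → RBimodule R)
  (f : ∀ g h, ((Γ g).tensor (Γ h)).carrier →ₗ[R] (Γ (g * h)).carrier)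

instance : AddCommGroup (CrossedProduct Γ f) :=
  inferInstanceAs (AddCommGroup (⨁ g, (Γ g).carrier))

/-- The left action of `R`. -/
instance : Module R (CrossedProduct Γ f) :=
  inferInstanceAs (Module R (⨁ g, (Γ g).carrier))

/-- The biadditive map `(x, y) ↦ f_{g,h}(x ⊗ y)`. -/
def homMul (g h : G) : (Γ g).carrier →+ (Γ h).carrier →+ (Γ (g * h)).carrier :=
  AddMonoidHom.mk' (fun x => AddMonoidHom.mk' (fun y => f g h (RBimodule.tmul x y))
    (fun y y' => by
      rw [← map_add]
      exact congrArg (f g h) (congrArg (Submodule.Quotient.mk) (TensorProduct.tmul_add x y y'))))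
    (fun x x' => by
      ext y
      change _ = f g h _ + f g h _
      rw [← map_add]
      exact congrArg (f g h) (congrArg (Submodule.Quotient.mk) (TensorProduct.add_tmul x x' y)))

open Classical in
/-- The biadditive multiplication of `Δ(Γ)`, given by `x ∘ y = f_{g,h}(x ⊗ y) ∈ Γ_{gh}` for
`x ∈ Γ_g` and `y ∈ Γ_h`. -/
noncomputable def mulHom : (⨁ g, (Γ g).carrier) →+ (⨁ g, (Γ g).carrier) →+ ⨁ g, (Γ g).carrier :=
  DirectSum.toAddMonoid fun g =>
    AddMonoidHom.flip <| DirectSum.toAddMonoid fun h =>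
      AddMonoidHom.flip <|
        (DirectSum.of (fun g => (Γ g).carrier) (g * h)).compHom.comp <| homMul Γ f g h

noncomputable instance : NonUnitalNonAssocRing (CrossedProduct Γ f) :=
  { (inferInstance : AddCommGroup (CrossedProduct Γ f)) with
    mul := fun x y => mulHom Γ f x y
    left_distrib := fun x y z => map_add (mulHom Γ f x) y z
    right_distrib := fun x y z => DFunLike.congr_fun (map_add (mulHom Γ f) x y) z
    zero_mul := fun x => DFunLike.congr_fun (map_zero (mulHom Γ f)) x
    mul_zero := fun x => map_zero (mulHom Γ f x) }

open Classical in
/-- The copy of `Γ g` in `Δ(Γ)`. -/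
noncomputable def of (g : G) (x : (Γ g).carrier) : CrossedProduct Γ f :=
  DirectSum.of (fun g => (Γ g).carrier) g x

lemma of_mul_of (g h : G) (x : (Γ g).carrier) (y : (Γ h).carrier) :
    of Γ f g x * of Γ f h y = of Γ f (g * h) (f g h (RBimodule.tmul x y)) := by
  classical
  change mulHom Γ f _ _ = _
  simp only [mulHom, of, DirectSum.toAddMonoid_of, AddMonoidHom.flip_apply]
  rfl

/-- `Δ(Γ)` and the `k`-algebra `B` are isomorphic as `k`-algebras, for a subring `k` of `R`: there
is an additive, multiplicative and `k`-linear bijection. (It transports the identity and the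
associativity of `B` to `Δ(Γ)`.) -/
def AlgIso (k : Subring R) (B : Type*) [Ring B] [Algebra k B] : Prop :=
  ∃ Φ : CrossedProduct Γ f ≃+* B, ∀ (c : k) (x : CrossedProduct Γ f), Φ ((c : R) • x) = c • Φ x

end CrossedProduct

end CrossedProduct

/-! ### Unital partial actions -/

/-- A unital partial action of `G` on the commutative ring `R`, with the ideals `D_g = R 1_g`
generated by idempotents `1_g = idem g` and the ring isomorphisms `α_g = equiv g : D_{g⁻¹} → D_g`. -/
structure UnitalPartialAction (G : Type v) [Group G] (R : Type u) [CommRing R] where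
  idem : G → R
  idem_mul_idem : ∀ g, IsIdempotentElem (idem g)
  equiv : ∀ g, (Ideal.span {idem g⁻¹} : Ideal R) ≃+ (Ideal.span {idem g} : Ideal R)
  equiv_mul : ∀ g (x y : (Ideal.span {idem g⁻¹} : Ideal R)),
    (equiv g ⟨(x : R) * y, Ideal.mul_mem_right _ _ x.2⟩ : R) = equiv g x * equiv g y
  span_one : (Ideal.span {idem 1} : Ideal R) = ⊤
  equiv_one : ∀ x, (equiv 1 x : R) = x
  /-- `α_h⁻¹(D_h ∩ D_{g⁻¹}) ⊆ D_{(gh)⁻¹}`. -/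
  mem_of_equiv_mem : ∀ g h (s : (Ideal.span {idem h⁻¹} : Ideal R)),
    (equiv h s : R) ∈ (Ideal.span {idem g⁻¹} : Ideal R) →
      (s : R) ∈ (Ideal.span {idem (g * h)⁻¹} : Ideal R)
  /-- `α_g(α_h(s)) = α_{gh}(s)` for `s ∈ α_h⁻¹(D_h ∩ D_{g⁻¹})`. -/
  equiv_equiv : ∀ g h (s : (Ideal.span {idem h⁻¹} : Ideal R))
    (hs : (equiv h s : R) ∈ (Ideal.span {idem g⁻¹} : Ideal R)),
    (equiv g ⟨equiv h s, hs⟩ : R) = equiv (g * h) ⟨s, mem_of_equiv_mem g h s hs⟩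

namespace UnitalPartialAction

variable {G : Type v} [Group G] {R : Type u} [CommRing R] (α : UnitalPartialAction G R)

/-- The ideal `D_g = R 1_g`. -/
abbrev D (g : G) : Ideal R := Ideal.span {α.idem g}

lemma mem_D {g : G} {x : R} : x ∈ α.D g ↔ x * α.idem g = x := by
  rw [Ideal.mem_span_singleton']
  constructor
  · rintro ⟨y, rfl⟩
    rw [mul_assoc, α.idem_mul_idem g]
  · intro h
    exact ⟨x, h⟩

lemma mul_idem_mem (g : G) (r : R) : r * α.idem g ∈ α.D g :=
  Ideal.mul_mem_left _ _ (Ideal.mem_span_singleton_self _)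

/-- `act g r = α_g(r 1_{g⁻¹})`, for any `r ∈ R`. -/
def act (g : G) (r : R) : R := α.equiv g ⟨r * α.idem g⁻¹, α.mul_idem_mem g⁻¹ r⟩

lemma act_mem (g : G) (r : R) : α.act g r ∈ α.D g := (α.equiv g _).2

lemma act_mul_idem (g : G) (r : R) : α.act g r * α.idem g = α.act g r :=
  α.mem_D.1 (α.act_mem g r)

lemma act_add (g : G) (r s : R) : α.act g (r + s) = α.act g r + α.act g s := by
  unfold act
  rw [← Submodule.coe_add, ← map_add]
  congr 3
  simp [add_mul]

lemma act_zero (g : G) : α.act g 0 = 0 := by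
  have := α.act_add g 0 0
  simpa using this

lemma act_mul (g : G) (r s : R) : α.act g (r * s) = α.act g r * α.act g s := by
  unfold act
  rw [← α.equiv_mul]
  congr 3
  linear_combination (r * s) * -(α.idem_mul_idem g⁻¹).eq

lemma act_of_mem (g : G) (x : α.D g⁻¹) : α.act g x = α.equiv g x := by
  unfold act
  congr 2
  exact Subtype.ext (α.mem_D.1 x.2)

lemma act_one (g : G) : α.act g 1 = α.idem g := by
  obtain ⟨x, hx⟩ := (α.equiv g).surjective ⟨α.idem g, Ideal.mem_span_singleton_self _⟩
  have h1 : α.act g x = α.idem g := by rw [act_of_mem, hx]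
  have h2 := α.act_mul g x 1
  rw [mul_one, h1, mul_comm, act_mul_idem] at h2
  exact h2.symm

lemma act_mul_idem_inv (g : G) (r : R) : α.act g (r * α.idem g⁻¹) = α.act g r := by
  unfold act
  congr 3
  rw [mul_assoc, α.idem_mul_idem g⁻¹]

lemma idem_one : α.idem 1 = 1 := by
  have : (1 : R) ∈ α.D 1 := by rw [D, α.span_one]; trivial
  simpa using α.mem_D.1 this

lemma act_one_left (r : R) : α.act 1 r = r := by
  unfold act
  rw [α.equiv_one]
  simp [α.idem_one]

/-- `α_h(s) ∈ D_{g⁻¹}` implies `s ∈ D_{(gh)⁻¹}` and `α_g(α_h(s)) = α_{gh}(s)`, for `s ∈ D_{h⁻¹}`. -/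
lemma act_act_of_mem (g h : G) (s : R) (h1 : s ∈ α.D h⁻¹) (h2 : α.act h s ∈ α.D g⁻¹) :
    s ∈ α.D (g * h)⁻¹ ∧ α.act g (α.act h s) = α.act (g * h) s := by
  have e1 : α.act h s = α.equiv h ⟨s, h1⟩ := α.act_of_mem h ⟨s, h1⟩
  rw [e1] at h2
  have h3 := α.mem_of_equiv_mem g h ⟨s, h1⟩ h2
  refine ⟨h3, ?_⟩
  have := α.equiv_equiv g h ⟨s, h1⟩ h2
  rw [← α.act_of_mem g, ← α.act_of_mem (g * h)] at this
  rw [e1]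
  exact this

lemma act_inv_act (g : G) (x : R) (hx : x ∈ α.D g⁻¹) : α.act g⁻¹ (α.act g x) = x := by
  have h2 : α.act g x ∈ α.D (g⁻¹)⁻¹ := by rw [inv_inv]; exact α.act_mem g x
  rw [(α.act_act_of_mem g⁻¹ g x hx h2).2, inv_mul_cancel, act_one_left]

lemma act_act_inv (g : G) (x : R) (hx : x ∈ α.D g) : α.act g (α.act g⁻¹ x) = x := by
  have h2 : x ∈ α.D (g⁻¹)⁻¹ := by rwa [inv_inv]
  simpa using α.act_inv_act g⁻¹ x h2

lemma act_mem_of_mem (g h : G) (x : R) (hx : x ∈ α.D g⁻¹) (hx' : x ∈ α.D h) :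
    α.act g x ∈ α.D (g * h) := by
  have h2 : α.act g⁻¹ (α.act g x) ∈ α.D (h⁻¹)⁻¹ := by rwa [α.act_inv_act g x hx, inv_inv]
  have := (α.act_act_of_mem h⁻¹ g⁻¹ (α.act g x) (by rw [inv_inv]; exact α.act_mem g x) h2).1
  simpa using this

lemma act_idem (g h : G) : α.act g (α.idem h) = α.idem g * α.idem (g * h) := by
  have hA : α.act g (α.idem h) * α.idem (g * h) = α.act g (α.idem h) := by
    rw [← α.mem_D, ← α.act_mul_idem_inv]
    refine α.act_mem_of_mem g h _ (α.mul_idem_mem _ _) ?_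
    rw [mul_comm]
    exact α.mul_idem_mem _ _
  set y := α.act g⁻¹ (α.idem g * α.idem (g * h)) with hy
  have hy1 : α.act g y = α.idem g * α.idem (g * h) := by
    apply α.act_act_inv
    rw [mul_comm]
    exact α.mul_idem_mem _ _
  have hy2 : y ∈ α.D h := by
    have := α.act_mem_of_mem g⁻¹ (g * h) (α.idem g * α.idem (g * h))
      (by rw [inv_inv, mul_comm]; exact α.mul_idem_mem _ _) (α.mul_idem_mem _ _)
    simpa using this
  have h3 : α.idem g * α.idem (g * h) * α.act g (α.idem h) = α.idem g * α.idem (g * h) := by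
    rw [← hy1, ← α.act_mul, α.mem_D.1 hy2]
  rw [← h3, mul_assoc, mul_comm (α.idem (g * h)), hA, mul_comm, act_mul_idem]

lemma act_act (g h : G) (r : R) : α.act g (α.act h r) = α.act (g * h) r * α.idem g := by
  set z := α.act h⁻¹ (α.idem h * α.idem g⁻¹) with hz
  have hz0 : α.act h z = α.idem h * α.idem g⁻¹ := by
    apply α.act_act_inv
    rw [mul_comm]
    exact α.mul_idem_mem _ _
  have hzm : z ∈ α.D h⁻¹ := α.act_mem _ _
  have h1 : α.act h (r * z) = α.act h r * α.idem g⁻¹ := by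
    rw [α.act_mul, hz0, ← mul_assoc, act_mul_idem]
  have h2 := (α.act_act_of_mem g h (r * z) (Ideal.mul_mem_left _ _ hzm)
    (by rw [h1]; exact α.mul_idem_mem _ _)).2
  have h3 := (α.act_act_of_mem g h z hzm (by rw [hz0]; exact α.mul_idem_mem _ _)).2
  rw [h1, α.act_mul_idem_inv, α.act_mul, ← h3, hz0, α.act_mul_idem_inv, α.act_idem] at h2
  rw [h2, mul_comm (α.idem g), ← mul_assoc, act_mul_idem]

/-- The ring of invariants `R^α = {r | α_g(r 1_{g⁻¹}) = r 1_g for all g}`. -/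
def invariants : Subring R where
  carrier := {r | ∀ g, α.act g r = r * α.idem g}
  zero_mem' := fun g => by rw [act_zero, zero_mul]
  one_mem' := fun g => by rw [act_one, one_mul]
  add_mem' := fun {a b} ha hb g => by rw [act_add, ha g, hb g, add_mul]
  mul_mem' := fun {a b} ha hb g => by
    rw [act_mul, ha g, hb g]
    linear_combination (a * b) * (α.idem_mul_idem g).eq
  neg_mem' := fun {a} ha g => by
    have := α.act_add g a (-a)
    rw [add_neg_cancel, act_zero, ha g] at this
    linear_combination -this

/-- `R` is a partial Galois extension of `R^α`: there are `x_i, y_i ∈ R` with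
`∑ x_i α_g(y_i 1_{g⁻¹}) = δ_{1,g}` for all `g`. -/
def IsPartialGalois : Prop :=
  ∃ (m : ℕ) (x y : Fin m → R), ∑ i, x i * α.act 1 (y i) = 1 ∧
    ∀ g, g ≠ 1 → ∑ i, x i * α.act g (y i) = 0

/-- The bimodule `(D_g)_{g⁻¹}`: the set `D_g` with `r * d = r d` and `d * r = d α_g(r 1_{g⁻¹})`. -/
def thetaBimod (g : G) : RBimodule R :=
  RBimodule.ofActions (α.D g) (Module.toAddMonoidEnd R (α.D g))
    { toFun := fun r => Module.toAddMonoidEnd R (α.D g) (α.act g r)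
      map_one' := by
        ext d
        rw [act_one]
        change α.idem g * (d : R) = d
        rw [mul_comm]
        exact α.mem_D.1 d.2
      map_mul' := fun r s => by rw [act_mul, map_mul]
      map_zero' := by rw [act_zero, map_zero]
      map_add' := fun r s => by rw [act_add, map_add] }
    (fun r s x => smul_comm r (α.act g s) x)

/-- The map `Θ(g) = [(D_g)_{g⁻¹}]`. -/
def theta (g : G) : BimodClass R := BimodClass.mk (α.thetaBimod g)

/-- The elements `p` of `P` with `1_{g⁻¹} p = p = p 1_{g⁻¹}`. -/
def cut (g : G) (P : RBimodule R) : AddSubgroup P.carrier where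
  carrier := {p | α.idem g⁻¹ • p = p ∧ op (α.idem g⁻¹) • p = p}
  zero_mem' := ⟨smul_zero _, smul_zero _⟩
  add_mem' := fun {a b} ha hb => ⟨by rw [smul_add, ha.1, hb.1], by rw [smul_add, ha.2, hb.2]⟩
  neg_mem' := fun {a} ha => ⟨by rw [smul_neg, ha.1], by rw [smul_neg, ha.2]⟩

/-- The bimodule `P_g`: the set `P` with the actions `r • p = α_{g⁻¹}(r 1_g) p` and
`p • r = p α_{g⁻¹}(r 1_g)`. This needs `1_{g⁻¹} p = p = p 1_{g⁻¹}` for all `p`, so that in general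
`P` is first replaced by the part where this is true. -/
def twist (g : G) (P : RBimodule R) : RBimodule R :=
  RBimodule.ofActions (α.cut g P)
    { toFun := fun r => AddMonoidHom.mk' (fun p => ⟨α.act g⁻¹ r • (p : P.carrier),
          by rw [smul_comm, p.2.1], by rw [← smul_comm, p.2.2]⟩)
          (fun p q => Subtype.ext (smul_add _ _ _))
      map_one' := AddMonoidHom.ext fun p => Subtype.ext (by
        change α.act g⁻¹ 1 • (p : P.carrier) = p
        rw [act_one, p.2.1])
      map_mul' := fun r s => AddMonoidHom.ext fun p => Subtype.ext (by
        change α.act g⁻¹ (r * s) • (p : P.carrier) = α.act g⁻¹ r • α.act g⁻¹ s • (p : P.carrier)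
        rw [act_mul, mul_smul])
      map_zero' := AddMonoidHom.ext fun p => Subtype.ext (by
        change α.act g⁻¹ 0 • (p : P.carrier) = 0
        rw [act_zero, zero_smul])
      map_add' := fun r s => AddMonoidHom.ext fun p => Subtype.ext (by
        change α.act g⁻¹ (r + s) • (p : P.carrier) =
          α.act g⁻¹ r • (p : P.carrier) + α.act g⁻¹ s • (p : P.carrier)
        rw [act_add, add_smul]) }
    { toFun := fun r => AddMonoidHom.mk' (fun p => ⟨op (α.act g⁻¹ r) • (p : P.carrier),
          by rw [smul_comm, p.2.1],
          by rw [← mul_smul, ← op_mul, mul_comm, op_mul, mul_smul, p.2.2]⟩)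
          (fun p q => Subtype.ext (smul_add _ _ _))
      map_one' := AddMonoidHom.ext fun p => Subtype.ext (by
        change op (α.act g⁻¹ 1) • (p : P.carrier) = p
        rw [act_one, p.2.2])
      map_mul' := fun r s => AddMonoidHom.ext fun p => Subtype.ext (by
        change op (α.act g⁻¹ (r * s)) • (p : P.carrier) =
          op (α.act g⁻¹ r) • op (α.act g⁻¹ s) • (p : P.carrier)
        rw [act_mul, mul_comm, op_mul, mul_smul])
      map_zero' := AddMonoidHom.ext fun p => Subtype.ext (by
        change op (α.act g⁻¹ 0) • (p : P.carrier) = 0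
        rw [act_zero, op_zero, zero_smul])
      map_add' := fun r s => AddMonoidHom.ext fun p => Subtype.ext (by
        change op (α.act g⁻¹ (r + s)) • (p : P.carrier) =
          op (α.act g⁻¹ r) • (p : P.carrier) + op (α.act g⁻¹ s) • (p : P.carrier)
        rw [act_add, op_add, add_smul]) }
    (fun r s p => Subtype.ext (smul_comm (α.act g⁻¹ r) (op (α.act g⁻¹ s)) (p : P.carrier)))

lemma twist_congr (g : G) {P Q : RBimodule R} : P.Iso Q → (α.twist g P).Iso (α.twist g Q) := by
  rintro ⟨e, he⟩
  have h : ∀ p, p ∈ α.cut g P ↔ e p ∈ α.cut g Q := by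
    intro p
    change (_ ∧ _) ↔ (_ ∧ _)
    rw [← he, ← map_smul, e.injective.eq_iff, e.injective.eq_iff]
  let E : α.cut g P ≃ α.cut g Q := e.toEquiv.subtypeEquiv h
  let E' : (α.twist g P).carrier ≃ₗ[R] (α.twist g Q).carrier :=
    { E with
      map_add' := fun x y => Subtype.ext (map_add e x.1 y.1)
      map_smul' := fun r x => Subtype.ext (map_smul e (α.act g⁻¹ r) x.1) }
  exact ⟨E', fun r x => Subtype.ext (he (α.act g⁻¹ r) x.1)⟩

/-- The isomorphisms `α*_g : X_{g⁻¹} → X_g`, `[P] ↦ [P_g]`, of the partial action of `G` on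
`PicS_R(R)`. -/
def actStar (g : G) : BimodClass R → BimodClass R :=
  Quotient.map (α.twist g) fun _ _ h => α.twist_congr g h

/-- The ideal `X_g = PicS_R(R) [D_g]` of `PicS_R(R)`. -/
def X (g : G) : Set (BimodClass R) :=
  {x | ∃ y ∈ BimodClass.PicSOver (⊤ : Subring R), x = y * BimodClass.ofIdem (α.idem g)}

/-- `f ∈ Z¹(G, α*, PicS_R(R))`: every `f(g)` is an invertible element of the monoid `X_g`, whose
neutral element is `[D_g]`, and `α*_g(f(h)[D_{g⁻¹}]) f(g) = f(gh)[D_g]`. -/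
structure IsOneCocycle (f : G → BimodClass R) : Prop where
  isUnit : ∀ g, f g ∈ α.X g ∧ ∃ y ∈ α.X g, f g * y = BimodClass.ofIdem (α.idem g) ∧
    y * f g = BimodClass.ofIdem (α.idem g)
  cocycle : ∀ g h, α.actStar g (f h * BimodClass.ofIdem (α.idem g⁻¹)) * f g =
    f (g * h) * BimodClass.ofIdem (α.idem g)

/-- The `R^α`-algebra `B` is a partial generalized crossed product `Δ(Γ)`, for a unital partial
representation `Γ` of the form `f Θ`, `f ∈ Z¹(G, α*, PicS_R(R))`, and a factor set of `Γ`. -/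
def IsPartialGeneralizedCrossedProduct (B : Type*) [Ring B] [Algebra α.invariants B] : Prop :=
  ∃ (f : G → BimodClass R) (Γ : G → RBimodule R)
    (m : ∀ g h, ((Γ g).tensor (Γ h)).carrier →ₗ[R] (Γ (g * h)).carrier),
    α.IsOneCocycle f ∧ (∀ g, BimodClass.mk (Γ g) = f g * α.theta g) ∧
    IsUnitalPartialRep α.idem Γ ∧ IsFactorSet α.idem Γ m ∧
    CrossedProduct.AlgIso Γ m α.invariants B

/-! ### The cocycle and the partial representation of an algebra containing `R` -/

section Algebra

variable {A : Type u} [Ring A] (ι : R →+* A)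

/-- `C_g = {a ∈ 1_{g⁻¹} A | α_{g⁻¹}(r 1_g) a = a r for all r ∈ R}`. -/
def C (g : G) : AddSubgroup A where
  carrier := {a | (∃ b, a = ι (α.idem g⁻¹) * b) ∧ ∀ r, ι (α.act g⁻¹ r) * a = a * ι r}
  zero_mem' := ⟨⟨0, by simp⟩, by simp⟩
  add_mem' := by
    rintro a b ⟨⟨a', ha'⟩, ha⟩ ⟨⟨b', hb'⟩, hb⟩
    exact ⟨⟨a' + b', by rw [ha', hb', mul_add]⟩, fun r => by rw [mul_add, add_mul, ha, hb]⟩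
  neg_mem' := by
    rintro a ⟨⟨a', ha'⟩, ha⟩
    exact ⟨⟨-a', by rw [ha', mul_neg]⟩, fun r => by rw [mul_neg, neg_mul, ha]⟩

variable {ι} in
lemma idem_mul_of_mem_C {g : G} {a : A} (ha : a ∈ α.C ι g) : ι (α.idem g⁻¹) * a = a := by
  have := ha.2 1
  rwa [act_one, map_one, mul_one] at this

variable {ι} in
lemma mem_C_of_forall {g : G} {a : A} (ha : ∀ r, ι (α.act g⁻¹ r) * a = a * ι r) :
    a ∈ α.C ι g := by
  refine ⟨⟨a, ?_⟩, ha⟩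
  have := ha 1
  rw [act_one, map_one, mul_one] at this
  exact this.symm

variable {ι} in
lemma mul_right_mem_C {g : G} {a : A} (ha : a ∈ α.C ι g) (r : R) : a * ι r ∈ α.C ι g :=
  α.mem_C_of_forall fun s => by
    rw [← mul_assoc, ha.2, mul_assoc, mul_assoc, ← map_mul, ← map_mul, mul_comm]

variable {ι} in
lemma mul_left_mem_C {g : G} {a : A} (ha : a ∈ α.C ι g) (r : R) : ι r * a ∈ α.C ι g :=
  α.mem_C_of_forall fun s => by
    rw [mul_assoc, ← ha.2, ← mul_assoc, ← mul_assoc, ← map_mul, ← map_mul, mul_comm]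

variable {ι} in
lemma mul_mem_C {g h : G} {a b : A} (ha : a ∈ α.C ι g) (hb : b ∈ α.C ι h) :
    b * a ∈ α.C ι (g * h) :=
  α.mem_C_of_forall fun r => by
    rw [mul_assoc, ← ha.2, ← mul_assoc b, ← hb.2, act_act, mul_inv_rev, map_mul, mul_assoc _ _ b,
      α.idem_mul_of_mem_C hb, mul_assoc]

/-- The action `(r, a) ↦ a r` of `R` on `C_g`; here `a r = α_{g⁻¹}(r 1_g) a`. -/
def rightAct (g : G) : R →+* AddMonoid.End (α.C ι g) where
  toFun r := AddMonoidHom.mk' (fun a => ⟨a.1 * ι r, α.mul_right_mem_C a.2 r⟩)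
    (fun a b => Subtype.ext (add_mul a.1 b.1 _))
  map_one' := AddMonoidHom.ext fun a => Subtype.ext (by
    change a.1 * ι 1 = a.1
    rw [map_one, mul_one])
  map_mul' r s := AddMonoidHom.ext fun a => Subtype.ext (by
    change a.1 * ι (r * s) = a.1 * ι s * ι r
    rw [mul_comm, map_mul, mul_assoc])
  map_zero' := AddMonoidHom.ext fun a => Subtype.ext (by
    change a.1 * ι 0 = 0
    rw [map_zero, mul_zero])
  map_add' r s := AddMonoidHom.ext fun a => Subtype.ext (by
    change a.1 * ι (r + s) = a.1 * ι r + a.1 * ι s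
    rw [map_add, mul_add])

/-- The action `(r, a) ↦ r a` of `R` on `C_g`; here `r a = a α_g(r 1_{g⁻¹})`. -/
def leftAct (g : G) : R →+* AddMonoid.End (α.C ι g) where
  toFun r := AddMonoidHom.mk' (fun a => ⟨ι r * a.1, α.mul_left_mem_C a.2 r⟩)
    (fun a b => Subtype.ext (mul_add _ a.1 b.1))
  map_one' := AddMonoidHom.ext fun a => Subtype.ext (by
    change ι 1 * a.1 = a.1
    rw [map_one, one_mul])
  map_mul' r s := AddMonoidHom.ext fun a => Subtype.ext (by
    change ι (r * s) * a.1 = ι r * (ι s * a.1)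
    rw [map_mul, mul_assoc])
  map_zero' := AddMonoidHom.ext fun a => Subtype.ext (by
    change ι 0 * a.1 = 0
    rw [map_zero, zero_mul])
  map_add' r s := AddMonoidHom.ext fun a => Subtype.ext (by
    change ι (r + s) * a.1 = ι r * a.1 + ι s * a.1
    rw [map_add, add_mul])

/-- `C_g` as a central `R`-bimodule, with `r · a = α_{g⁻¹}(r 1_g) a = a r`. -/
def cBimod (g : G) : RBimodule R :=
  RBimodule.ofActions (α.C ι g) (α.rightAct ι g) (α.rightAct ι g) fun r s a =>
    Subtype.ext (by
      change a.1 * ι s * ι r = a.1 * ι r * ι s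
      rw [mul_assoc, mul_assoc, ← map_mul, ← map_mul, mul_comm])

/-- The map `f_A`, `f_A(g) = [C_g]`. -/
def fA (g : G) : BimodClass R := BimodClass.mk (α.cBimod ι g)

/-- The bimodule `Γ_g`: the set `C_g` with `r ⋆ a = a r` and `a ⋆ r = r a`. -/
def gammaBimod (g : G) : RBimodule R :=
  RBimodule.ofActions (α.C ι g) (α.rightAct ι g) (α.leftAct ι g) fun r s a =>
    Subtype.ext (mul_assoc (ι s) a.1 (ι r))

/-- The map `Γ_g ⊗_R Γ_h → Γ_{gh}`, `u ⊗ v ↦ v u` (product in `A`). -/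
def gammaMul (g h : G) :
    ((α.gammaBimod ι g).tensor (α.gammaBimod ι h)).carrier →ₗ[R] (α.gammaBimod ι (g * h)).carrier :=
  RBimodule.lift (M := α.gammaBimod ι g) (N := α.gammaBimod ι h) (P := α.gammaBimod ι (g * h))
    (AddMonoidHom.mk' (fun u : α.C ι g => AddMonoidHom.mk'
        (fun v : α.C ι h => (⟨v.1 * u.1, α.mul_mem_C u.2 v.2⟩ : α.C ι (g * h)))
        (fun v w => Subtype.ext (add_mul v.1 w.1 u.1)))
      (fun u w => AddMonoidHom.ext fun v => Subtype.ext (mul_add v.1 u.1 w.1)))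
    (fun r u v => Subtype.ext (mul_assoc v.1 u.1 (ι r)).symm)
    (fun r u v => Subtype.ext (mul_assoc v.1 (ι r) u.1).symm)

end Algebra

end UnitalPartialAction

/-!
Let `k = R^α`. Given Galois coordinates `x_i, y_i`, the maps `p_g(a) = ∑_i α_{g⁻¹}(x_i 1_g) a y_i`
are orthogonal projections of `A` onto the `C_g` and add up to the identity
(`exists_isDecomposition`): they are the multiplications by the idempotents of `R ⊗_k R` that
correspond to the factors of `R ⊗_k R ≅ ∏_g D_g`. Hence `A = ⨁_g C_g`, with `C_h C_g ⊆ C_{gh}`,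
and `C_1` is the centralizer of `R`, which is `R` by maximality.

The one deeper point is `1_g ∈ C_{g⁻¹} C_g` (`isPartiallyStrong`). As `A` is Azumaya, the
`k`-linear map `a ↦ α_g(p_1(a) 1_{g⁻¹})` is of the form `a ↦ ∑_i b_i a d_i`. On `R`, the component
of degree one of this identity reads `α_g(r 1_{g⁻¹}) = ∑_l α_l(r 1_{l⁻¹}) t_l`, where `t_l = ∑_i
p_{l⁻¹}(b_i) p_l(d_i) ∈ C_{l⁻¹} C_l`. Galois coordinates separate the `α_l`, and give `1_g = t_g`.

If `1_g = ∑_i v_i u_i` with `v_i ∈ C_{g⁻¹}` and `u_i ∈ C_g`, then the map `Γ_g ⊗_R Γ_h → 1_g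
Γ_{gh}`, `u ⊗ v ↦ v u`, has the inverse `c ↦ ∑_i u_i ⊗ c v_i`, and `(u_i, v_i)` provides dual
bases of `C_g`. All isomorphisms of bimodules that the cocycle identity, the partial
representation and the factor set require are of this kind (`RBimodule.tensor_iso` is the common
pattern), so that associativity of the tensor product is not needed. The subbimodules `1_g Γ_h`
are treated as `RBimodule.cut`.

Since `u ⊗ v ↦ v u` reverses products, `Δ(Γ) ≅ Aᵐᵒᵖ`. That `A` itself is a partial generalized
crossed product follows from the same results for `Aᵐᵒᵖ`, which satisfies the same hypotheses.
-/

/-! ### Isomorphisms of tensor products, and partial invertibility -/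

namespace RBimodule

variable {R : Type u} [CommRing R]

lemma tmul_add {M N : RBimodule R} (m : M.carrier) (n n' : N.carrier) :
    tmul m (n + n') = tmul m n + tmul m n' :=
  congrArg (Submodule.Quotient.mk (p := tensorRel M N)) (TensorProduct.tmul_add m n n')

lemma add_tmul {M N : RBimodule R} (m m' : M.carrier) (n : N.carrier) :
    tmul (m + m') n = tmul m n + tmul m' n :=
  congrArg (Submodule.Quotient.mk (p := tensorRel M N)) (TensorProduct.add_tmul m m' n)

/-- The biadditive map `(m, n) ↦ m ⊗ n`. -/
def tmulHom (M N : RBimodule R) : M.carrier →+ N.carrier →+ (tensor M N).carrier :=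
  AddMonoidHom.mk' (fun m => AddMonoidHom.mk' (tmul m) (tmul_add m))
    fun m m' => AddMonoidHom.ext (add_tmul m m')

lemma tmul_sum {M N : RBimodule R} {ι : Type*} (s : Finset ι) (m : M.carrier)
    (n : ι → N.carrier) : tmul m (∑ i ∈ s, n i) = ∑ i ∈ s, tmul m (n i) :=
  map_sum (tmulHom M N m) n s

lemma sum_tmul {M N : RBimodule R} {ι : Type*} (s : Finset ι) (m : ι → M.carrier)
    (n : N.carrier) : tmul (∑ i ∈ s, m i) n = ∑ i ∈ s, tmul (m i) n :=
  map_sum ((tmulHom M N).flip n) m s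

@[elab_as_elim]
lemma tensor_induction {M N : RBimodule R} {p : (tensor M N).carrier → Prop} (zero : p 0)
    (tmul : ∀ m n, p (tmul m n)) (add : ∀ x y, p x → p y → p (x + y)) (x) : p x := by
  obtain ⟨x, rfl⟩ := Submodule.Quotient.mk_surjective _ x
  induction x with
  | zero => exact zero
  | tmul a b => exact tmul a b
  | add a b ha hb => exact add _ _ ha hb

/-- A balanced bilinear map `b : M × N → P` makes `P` a tensor product of `M` and `N` if the map
`P → M ⊗ N`, `p ↦ ∑ i, s i p ⊗ t i p`, is additive and inverse to the map induced by `b`. -/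
lemma tensor_iso {M N P : RBimodule R} (b : M.carrier → N.carrier → P.carrier)
    (add_left : ∀ m m' n, b (m + m') n = b m n + b m' n)
    (add_right : ∀ m n n', b m (n + n') = b m n + b m n')
    (smul_left : ∀ (r : R) m n, b (r • m) n = r • b m n)
    (balanced : ∀ (r : R) m n, b (op r • m) n = b m (r • n))
    (smul_right : ∀ (r : R) m n, b m (op r • n) = op r • b m n)
    {κ : Type*} [Fintype κ] (s : κ → P.carrier → M.carrier) (t : κ → P.carrier → N.carrier)
    (add : ∀ i p q, tmul (s i (p + q)) (t i (p + q)) =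
      tmul (s i p) (t i p) + tmul (s i q) (t i q))
    (left_inv : ∀ m n, ∑ i, tmul (s i (b m n)) (t i (b m n)) = tmul m n)
    (right_inv : ∀ p, ∑ i, b (s i p) (t i p) = p) : Iso (M.tensor N) P := by
  let f := lift (M := M) (N := N) (P := P)
    (AddMonoidHom.mk' (fun m => AddMonoidHom.mk' (b m) (add_right m))
      fun m m' => AddMonoidHom.ext (add_left m m')) smul_left balanced
  have hf : ∀ m n, f (tmul m n) = b m n := fun m n => rfl
  let S : P.carrier →+ (tensor M N).carrier :=
    AddMonoidHom.mk' (fun p => ∑ i, tmul (s i p) (t i p)) fun p q => by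
      simp only [add, Finset.sum_add_distrib]
  have hS : ∀ p, S p = ∑ i, tmul (s i p) (t i p) := fun p => rfl
  refine ⟨LinearEquiv.ofBijective f ⟨Function.LeftInverse.injective (g := S) fun x => ?_,
    Function.RightInverse.surjective (g := S) fun p => ?_⟩, fun r x => ?_⟩
  · induction x using tensor_induction with
    | zero => simp
    | tmul m n => rw [hf, hS, left_inv]
    | add x y hx hy => rw [map_add, map_add, hx, hy]
  · rw [hS, map_sum]
    simp only [hf, right_inv]
  · change f (op r • x) = op r • f x
    induction x using tensor_induction with
    | zero => simp
    | tmul m n => rw [op_smul_tmul, hf, hf, smul_right]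
    | add x y hx hy => rw [smul_add, map_add, map_add, smul_add, hx, hy]

/-- The submodule `{p | e p = p}` of `P`; it is `e P` if `e` is idempotent. -/
def cutSubmodule (P : RBimodule R) (e : R) : Submodule R P.carrier where
  carrier := {p | e • p = p}
  zero_mem' := smul_zero e
  add_mem' := fun {p q} hp hq => by
    change e • (p + q) = p + q
    rw [smul_add, hp, hq]
  smul_mem' := fun r p hp => by
    change e • r • p = r • p
    rw [smul_comm, hp]

/-- The submodule `{p | e p = p}` of `P`, as a bimodule. -/
def cut (P : RBimodule R) (e : R) : RBimodule R :=
  ofActions (P.cutSubmodule e) (Module.toAddMonoidEnd R _)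
    { toFun := fun r => AddMonoidHom.mk' (fun p => ⟨op r • p.1, by
          change e • op r • p.1 = op r • p.1
          rw [smul_comm, p.2]⟩) fun p q => Subtype.ext (smul_add _ _ _)
      map_one' := AddMonoidHom.ext fun p => Subtype.ext (one_smul Rᵐᵒᵖ p.1)
      map_mul' := fun r s => AddMonoidHom.ext fun p => Subtype.ext (by
        change op (r * s) • p.1 = op r • op s • p.1
        rw [mul_comm, op_mul, mul_smul])
      map_zero' := AddMonoidHom.ext fun p => Subtype.ext (zero_smul Rᵐᵒᵖ p.1)
      map_add' := fun r s => AddMonoidHom.ext fun p => Subtype.ext (add_smul (op r) (op s) p.1) }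
    fun r s p => Subtype.ext (smul_comm r (op s) p.1)

lemma cut_iso_cut {P : RBimodule R} {e e' : R} (h : ∀ p : P.carrier, e • p = p ↔ e' • p = p) :
    Iso (P.cut e) (P.cut e') :=
  ⟨{ Equiv.subtypeEquivRight (p := fun p => p ∈ P.cutSubmodule e)
        (q := fun p => p ∈ P.cutSubmodule e') h with
      map_add' := fun _ _ => rfl
      map_smul' := fun _ _ => rfl }, fun _ _ => rfl⟩

lemma cut_iso_self {P : RBimodule R} {e : R} (h : ∀ p : P.carrier, e • p = p) :
    Iso (P.cut e) P :=
  ⟨{ toFun := Subtype.val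
     invFun := fun p => ⟨p, h p⟩
     left_inv := fun _ => rfl
     right_inv := fun _ => rfl
     map_add' := fun _ _ => rfl
     map_smul' := fun _ _ => rfl }, fun _ _ => rfl⟩

/-- `P ⊗_R R e ≅ P e` for a central bimodule `P`. -/
lemma tensor_ideal_iso_cut {P : RBimodule R} (hP : ∀ (r : R) (p : P.carrier), op r • p = r • p)
    {e : R} (he : IsIdempotentElem e) :
    Iso (P.tensor (central (Ideal.span {e} : Ideal R))) (P.cut e) := by
  have hI : ∀ d ∈ (Ideal.span {e} : Ideal R), e * d = d := by
    intro d hd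
    obtain ⟨y, rfl⟩ := Ideal.mem_span_singleton'.1 hd
    rw [mul_left_comm, he.eq]
  refine tensor_iso (M := P) (N := central (Ideal.span {e} : Ideal R)) (P := P.cut e) (κ := Unit)
    (fun (p : P.carrier) (d : (Ideal.span {e} : Ideal R)) =>
      (⟨(d : R) • p, ?_⟩ : P.cutSubmodule e))
    (fun p q d => Subtype.ext (smul_add _ _ _)) (fun p d d' => Subtype.ext (add_smul _ _ _))
    (fun r p d => Subtype.ext (smul_comm _ _ _)) (fun r p d => Subtype.ext ?_)
    (fun r p d => Subtype.ext ?_)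
    (fun _ p => p.1) (fun _ _ => (⟨e, Ideal.mem_span_singleton_self e⟩ : Ideal.span {e}))
    (fun _ p q => add_tmul p.1 q.1 _) (fun p d => ?_) (fun p => Subtype.ext ?_)
  · change e • (d : R) • p = (d : R) • p
    rw [smul_smul, hI d d.2]
  · change d.1 • op r • p = (r • d.1) • p
    rw [hP, smul_smul, smul_eq_mul, mul_comm]
  · change (r • d.1) • p = op r • d.1 • p
    rw [hP, smul_smul, smul_eq_mul]
  · refine (Fintype.sum_unique _).trans ?_
    change tmul (d.1 • p) _ = _
    rw [← hP]
    refine (op_smul_tmul_eq (N := central (Ideal.span {e} : Ideal R)) d.1 p _).trans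
      (congrArg (tmul p) (Subtype.ext ?_))
    change d.1 • e = d.1
    rw [smul_eq_mul, mul_comm, hI d.1 d.2]
  · exact (congrArg Subtype.val (Fintype.sum_unique _)).trans p.2

/-- Tensor products of central bimodules commute. -/
lemma tensor_comm_of_central {M N : RBimodule R}
    (hM : ∀ (r : R) (m : M.carrier), op r • m = r • m)
    (hN : ∀ (r : R) (n : N.carrier), op r • n = r • n) : Iso (M.tensor N) (N.tensor M) := by
  have key : ∀ {M N : RBimodule R}, (∀ (r : R) (m : M.carrier), op r • m = r • m) →
      (∀ (r : R) (n : N.carrier), op r • n = r • n) →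
      ∃ f : (M.tensor N).carrier →ₗ[R] (N.tensor M).carrier, ∀ m n, f (tmul m n) = tmul n m :=
    fun {M N} hM hN => ⟨lift (P := N.tensor M) (tmulHom N M).flip
      (fun r m n => by
        change tmul n (r • m) = r • tmul n m
        rw [← op_smul_tmul_eq, hN, smul_tmul])
      (fun r m n => by
        change tmul n (op r • m) = tmul (r • n) m
        rw [hM, ← op_smul_tmul_eq, hN]), fun m n => rfl⟩
  obtain ⟨f, hf⟩ := key hM hN
  obtain ⟨f', hf'⟩ := key hN hM
  refine ⟨LinearEquiv.ofLinearMap f f' ?_ ?_, fun r x => ?_⟩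
  · ext x
    induction x using tensor_induction with
    | zero => simp
    | tmul m n => simp [hf, hf']
    | add x y hx hy => simp_all
  · ext x
    induction x using tensor_induction with
    | zero => simp
    | tmul m n => simp [hf, hf']
    | add x y hx hy => simp_all
  · change f (op r • x) = op r • f x
    induction x using tensor_induction with
    | zero => simp
    | tmul m n =>
      rw [op_smul_tmul, hf, hf, op_smul_tmul, hN, hM, ← op_smul_tmul_eq, hN]
    | add x y hx hy => rw [smul_add, map_add, map_add, smul_add, hx, hy]

/-- A bimodule with dual bases `(m i, s i)` on the left and `(n i, t i)` on the right, whose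
one-sided endomorphisms are multiplications, is partially invertible. -/
lemma isPartiallyInvertible_of_dualBasis {P : RBimodule R} {κ κ' : Type*}
    [Fintype κ] [Fintype κ'] (m : κ → P.carrier) (s : κ → P.carrier →+ R)
    (s_smul : ∀ i r p, s i (r • p) = r * s i p) (hs : ∀ p, ∑ i, s i p • m i = p)
    (n : κ' → P.carrier) (t : κ' → P.carrier →+ R)
    (t_smul : ∀ i r p, t i (op r • p) = r * t i p) (ht : ∀ p, ∑ i, op (t i p) • n i = p)
    (hr : ∀ φ : P.carrier →+ P.carrier, (∀ (r : R) p, φ (op r • p) = op r • φ p) →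
      ∃ r : R, ∀ p, φ p = r • p)
    (hl : ∀ φ : P.carrier →+ P.carrier, (∀ (r : R) p, φ (r • p) = r • φ p) →
      ∃ r : R, ∀ p, φ p = op r • p) :
    P.IsPartiallyInvertible := by
  let s' : P.carrier →ₗ[R] κ → R := LinearMap.pi fun i => { s i with map_smul' := s_smul i }
  let t' : P.carrier →ₗ[Rᵐᵒᵖ] κ' → Rᵐᵒᵖ := LinearMap.pi fun i =>
    { toFun := fun p => op (t i p)
      map_add' := fun p q => congrArg op (map_add (t i) p q)
      map_smul' := fun r p => congrArg op ((t_smul i (unop r) p).trans (mul_comm _ _)) }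
  have h1 : Fintype.linearCombination R m ∘ₗ s' = LinearMap.id :=
    LinearMap.ext hs
  have h2 : Fintype.linearCombination Rᵐᵒᵖ n ∘ₗ t' = LinearMap.id :=
    LinearMap.ext ht
  exact ⟨Module.Finite.of_surjective (Fintype.linearCombination R m)
      fun p => ⟨_, LinearMap.congr_fun h1 p⟩,
    Module.Projective.of_split _ _ h1,
    Module.Finite.of_surjective (Fintype.linearCombination Rᵐᵒᵖ n)
      fun p => ⟨_, LinearMap.congr_fun h2 p⟩,
    Module.Projective.of_split _ _ h2,
    fun φ => hr φ.toAddMonoidHom fun r p => map_smul φ (op r) p,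
    fun φ => hl φ.toAddMonoidHom fun r p => map_smul φ r p⟩

lemma isPartiallyInvertible_of_central {P : RBimodule R}
    (hP : ∀ (r : R) (p : P.carrier), op r • p = r • p) {κ : Type*} [Fintype κ]
    (m : κ → P.carrier) (s : κ → P.carrier →+ R)
    (s_smul : ∀ i r p, s i (r • p) = r * s i p) (hs : ∀ p, ∑ i, s i p • m i = p)
    (hl : ∀ φ : P.carrier →+ P.carrier, (∀ (r : R) p, φ (r • p) = r • φ p) →
      ∃ r : R, ∀ p, φ p = r • p) :
    P.IsPartiallyInvertible :=
  isPartiallyInvertible_of_dualBasis m s s_smul hs m s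
    (fun i r p => by rw [hP, s_smul]) (fun p => by simp only [hP, hs])
    (fun φ hφ => hl φ fun r p => by rw [← hP, hφ, hP])
    (fun φ hφ => by simpa only [hP] using hl φ hφ)

end RBimodule

namespace UnitalPartialAction

variable {G : Type v} [Group G] {R : Type u} [CommRing R] (α : UnitalPartialAction G R)

/-! ### Traces and Galois coordinates -/

lemma act_sum (g : G) {κ : Type*} (s : Finset κ) (x : κ → R) :
    α.act g (∑ i ∈ s, x i) = ∑ i ∈ s, α.act g (x i) :=
  map_sum (AddMonoidHom.mk' (α.act g) (α.act_add g)) x s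

lemma act_mul_of_mem_invariants {c : R} (hc : c ∈ α.invariants) (g : G) (r : R) :
    α.act g (r * c) = α.act g r * c := by
  rw [α.act_mul, hc g, mul_comm c, ← mul_assoc, α.act_mul_idem]

/-- The partial trace `∑_g α_g(x 1_{g⁻¹})`. -/
def trace [Fintype G] (x : R) : R := ∑ g, α.act g x

lemma trace_mem_invariants [Fintype G] (x : R) : α.trace x ∈ α.invariants := by
  intro h
  rw [trace, α.act_sum, Finset.sum_mul]
  simp only [α.act_act]
  exact Fintype.sum_equiv (Equiv.mulLeft h) _ _ fun g => rfl

/-- Galois coordinates of `R` over `R^α`, in the form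
`∑_i α_g(x_i 1_{g⁻¹}) α_h(y_i 1_{h⁻¹}) = δ_{g,h} 1_g`. -/
def IsGaloisCoordinates {m : ℕ} (x y : Fin m → R) : Prop :=
  (∀ g, ∑ i, α.act g (x i) * α.act g (y i) = α.idem g) ∧
    ∀ g h, g ≠ h → ∑ i, α.act g (x i) * α.act h (y i) = 0

lemma IsPartialGalois.exists_coordinates (hα : α.IsPartialGalois) :
    ∃ (m : ℕ) (x y : Fin m → R), α.IsGaloisCoordinates x y := by
  obtain ⟨m, x, y, h1, h2⟩ := hα
  have key : ∀ g h, ∑ i, α.act g (x i) * α.act h (y i) =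
      α.act g (∑ i, x i * α.act (g⁻¹ * h) (y i)) := by
    intro g h
    rw [α.act_sum]
    refine Finset.sum_congr rfl fun i _ => ?_
    rw [α.act_mul, α.act_act, mul_inv_cancel_left, mul_left_comm, α.act_mul_idem, mul_comm]
  refine ⟨m, x, y, fun g => ?_, fun g h hgh => ?_⟩
  · rw [key, inv_mul_cancel, h1, α.act_one]
  · rw [key, h2 _ (by rwa [Ne, inv_mul_eq_one]), α.act_zero]

section Coordinates

variable {α} {m : ℕ} {x y : Fin m → R}

lemma IsGaloisCoordinates.sum_eq [DecidableEq G] (hxy : α.IsGaloisCoordinates x y) (g h : G) :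
    ∑ i, α.act g (x i) * α.act h (y i) = if g = h then α.idem g else 0 := by
  split_ifs with hgh
  · rw [← hgh, hxy.1]
  · exact hxy.2 g h hgh

lemma IsGaloisCoordinates.sum_mul_trace [Fintype G] (hxy : α.IsGaloisCoordinates x y) (s : R) :
    ∑ i, x i * α.trace (y i * s) = s := by
  classical
  simp only [trace, Finset.mul_sum, α.act_mul]
  rw [Finset.sum_comm]
  have : ∀ g, ∑ i, x i * (α.act g (y i) * α.act g s) = if 1 = g then s else 0 := by
    intro g
    have := hxy.sum_eq 1 g
    simp only [α.act_one_left] at this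
    simp only [← mul_assoc, ← Finset.sum_mul, this]
    split_ifs with h
    · rw [← h, α.act_one_left, α.idem_one, one_mul]
    · rw [zero_mul]
  simp only [this, Finset.sum_ite_eq, Finset.mem_univ, if_true]

lemma IsGaloisCoordinates.sum_trace_mul [Fintype G] (hxy : α.IsGaloisCoordinates x y) (s : R) :
    ∑ i, α.trace (s * x i) * y i = s := by
  classical
  simp only [trace, Finset.sum_mul, α.act_mul]
  rw [Finset.sum_comm]
  have : ∀ g, ∑ i, α.act g s * α.act g (x i) * y i = if g = 1 then s else 0 := by
    intro g
    have := hxy.sum_eq g 1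
    simp only [α.act_one_left] at this
    simp only [mul_assoc, ← Finset.mul_sum, this]
    split_ifs with h
    · rw [h, α.act_one_left, α.idem_one, mul_one]
    · rw [mul_zero]
  simp only [this, Finset.sum_ite_eq', Finset.mem_univ, if_true]

end Coordinates

/-! ### The decomposition of an algebra over `R^α` that contains `R` -/

section Algebra

variable {α} {A : Type u} [Ring A] {ι : R →+* A}

lemma mul_idem_of_mem_C {g : G} {a : A} (ha : a ∈ α.C ι g) : a * ι (α.idem g) = a := by
  rw [← ha.2, ← α.act_one g, α.act_act, inv_mul_cancel, α.act_one_left, one_mul,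
    α.idem_mul_of_mem_C ha]

lemma map_mul_of_mem_C {g : G} {a : A} (ha : a ∈ α.C ι g) (r : R) :
    ι r * a = a * ι (α.act g r) := by
  rw [← ha.2, α.act_act, inv_mul_cancel, α.act_one_left, map_mul, mul_assoc,
    α.idem_mul_of_mem_C ha]

lemma mem_C_one {a : A} : a ∈ α.C ι 1 ↔ ∀ r, ι r * a = a * ι r := by
  constructor
  · intro ha r
    have := ha.2 r
    rwa [inv_one, α.act_one_left] at this
  · intro ha
    refine α.mem_C_of_forall fun r => ?_
    rw [inv_one, α.act_one_left, ha]

lemma map_mem_C_one (r : R) : ι r ∈ α.C ι 1 :=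
  mem_C_one.2 fun s => by rw [← map_mul, ← map_mul, mul_comm]

variable (α ι) in
/-- `A` is the direct sum of the `C_g`, with projections `p g : A → C_g` that are linear over
`R^α`. -/
structure IsDecomposition [Fintype G] (p : G → A →+ A) : Prop where
  mem : ∀ g a, p g a ∈ α.C ι g
  sum : ∀ a, ∑ g, p g a = a
  same : ∀ g, ∀ a ∈ α.C ι g, p g a = a
  ne : ∀ g h, g ≠ h → ∀ a ∈ α.C ι h, p g a = 0
  linear : ∀ g, ∀ c ∈ α.invariants, ∀ a, p g (ι c * a) = ι c * p g a

/-- The projection onto `C_g` is `a ↦ ∑_i α_{g⁻¹}(x_i 1_g) a y_i`, the multiplication by the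
idempotent of `R ⊗ R` over `R^α` that corresponds to the factor `D_{g⁻¹}` of
`R ⊗ R ≅ ∏_g D_g`. -/
lemma exists_isDecomposition [Fintype G] (hα : α.IsPartialGalois)
    (hc : ∀ c ∈ α.invariants, ∀ a, ι c * a = a * ι c) :
    ∃ p : G → A →+ A, α.IsDecomposition ι p := by
  classical
  obtain ⟨m, x, y, hxy⟩ := IsPartialGalois.exists_coordinates α hα
  have hterm : ∀ g h, ∀ a ∈ α.C ι h, ∑ i, ι (α.act g⁻¹ (x i)) * a * ι (y i) =
      if g = h then a else 0 := by
    intro g h a ha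
    simp only [mul_assoc, ← ha.2]
    simp only [← mul_assoc, ← map_mul, ← Finset.sum_mul, ← map_sum]
    rw [hxy.sum_eq]
    simp only [inv_inj]
    split_ifs with hgh
    · rw [hgh, α.idem_mul_of_mem_C ha]
    · rw [map_zero, zero_mul]
  refine ⟨fun g => AddMonoidHom.mk' (fun a => ∑ i, ι (α.act g⁻¹ (x i)) * a * ι (y i))
    fun a b => by simp only [mul_add, add_mul, Finset.sum_add_distrib], ?_, ?_, ?_, ?_, ?_⟩
  · intro g a
    refine α.mem_C_of_forall fun r => ?_
    have h1 : ∀ i, ι (α.act g⁻¹ (x i)) * a * ι (y i) * ι r =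
        ∑ j, ι (α.act g⁻¹ (x i * α.trace (y i * (r * x j)))) * a * ι (y j) := by
      intro i
      rw [mul_assoc _ (ι (y i)), ← map_mul, ← hxy.sum_trace_mul (y i * r), map_sum,
        Finset.mul_sum]
      refine Finset.sum_congr rfl fun j _ => ?_
      rw [map_mul, ← mul_assoc, mul_assoc _ a, ← hc _ (α.trace_mem_invariants _), ← mul_assoc,
        ← map_mul, ← α.act_mul_of_mem_invariants (α.trace_mem_invariants _), mul_assoc (y i)]
    change ι _ * ∑ i, ι (α.act g⁻¹ (x i)) * a * ι (y i) =
      (∑ i, ι (α.act g⁻¹ (x i)) * a * ι (y i)) * ι r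
    rw [Finset.mul_sum, Finset.sum_mul]
    simp only [h1]
    rw [Finset.sum_comm]
    refine Finset.sum_congr rfl fun j _ => ?_
    rw [← Finset.sum_mul, ← Finset.sum_mul, ← map_sum, ← α.act_sum, hxy.sum_mul_trace, α.act_mul,
      map_mul]
    simp only [mul_assoc]
  · intro a
    change ∑ g, ∑ i, ι (α.act g⁻¹ (x i)) * a * ι (y i) = a
    rw [Finset.sum_comm]
    have h1 : ∀ i, ∑ g : G, α.act g⁻¹ (x i) = α.trace (x i) := fun i =>
      Fintype.sum_equiv (Equiv.inv G) _ _ fun g => rfl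
    simp only [← Finset.sum_mul, ← map_sum, h1, hc _ (α.trace_mem_invariants _), mul_assoc,
      ← map_mul, ← Finset.mul_sum]
    have := hxy.sum_trace_mul 1
    simp only [one_mul] at this
    simp only [mul_comm (y _), this, map_one, mul_one]
  · intro g a ha
    exact (hterm g g a ha).trans (if_pos rfl)
  · intro g h hgh a ha
    exact (hterm g h a ha).trans (if_neg hgh)
  · intro g c hc' a
    change ∑ i, ι (α.act g⁻¹ (x i)) * (ι c * a) * ι (y i) =
      ι c * ∑ i, ι (α.act g⁻¹ (x i)) * a * ι (y i)
    rw [Finset.mul_sum]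
    refine Finset.sum_congr rfl fun i _ => ?_
    rw [← mul_assoc, ← hc c hc' (ι _)]
    simp only [mul_assoc]

variable (α ι) in
/-- `C_1 = R` and `1_g ∈ C_{g⁻¹} C_g` for all `g`; the second condition says that the grading of
`A` by the `C_g` is partially strong. -/
structure IsPartiallyStrong : Prop where
  injective : Function.Injective ι
  exists_map_eq : ∀ a ∈ α.C ι 1, ∃ r, ι r = a
  exists_sum_mul_eq : ∀ g, ∃ (n : ℕ) (v u : Fin n → A), (∀ i, v i ∈ α.C ι g⁻¹) ∧
    (∀ i, u i ∈ α.C ι g) ∧ ∑ i, v i * u i = ι (α.idem g)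

/-- If every `R^α`-linear endomorphism of `A` is of the form `a ↦ ∑ b_i a c_i`, then
`1_g ∈ C_{g⁻¹} C_g`. -/
lemma isPartiallyStrong [Finite G] (hα : α.IsPartialGalois)
    (hc : ∀ c ∈ α.invariants, ∀ a, ι c * a = a * ι c) (hι : Function.Injective ι)
    (hmax : ∀ a, (∀ r, ι r * a = a * ι r) → ∃ r, ι r = a)
    (hend : ∀ φ : A →+ A, (∀ c ∈ α.invariants, ∀ a, φ (ι c * a) = ι c * φ a) →
      ∃ (n : ℕ) (b d : Fin n → A), ∀ a, φ a = ∑ i, b i * a * d i) :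
    α.IsPartiallyStrong ι := by
  classical
  cases nonempty_fintype G
  obtain ⟨p, hp⟩ := exists_isDecomposition hα hc
  obtain ⟨m, x, y, hxy⟩ := IsPartialGalois.exists_coordinates α hα
  have hmax' : ∀ a ∈ α.C ι 1, ∃ r, ι r = a := fun a ha => hmax a (mem_C_one.1 ha)
  refine ⟨hι, hmax', fun g => ?_⟩
  choose π hπ using fun a => hmax' (p 1 a) (hp.mem 1 a)
  have hπr : ∀ r, π (ι r) = r := fun r =>
    hι (by rw [hπ, hp.same 1 _ (map_mem_C_one r)])
  -- `φ` extends `α_g` from `R` to `A`.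
  let φ : A →+ A := AddMonoidHom.mk' (fun a => ι (α.act g (π a))) fun a b => by
    have : π (a + b) = π a + π b := hι (by rw [map_add, hπ, hπ, hπ, map_add])
    rw [this, α.act_add, map_add]
  obtain ⟨n, b, d, hbd⟩ := hend φ fun c hc' a => by
    have : π (ι c * a) = π a * c := hι (by
      rw [map_mul, hπ, hπ, hp.linear _ _ hc', hc c hc'])
    change ι (α.act g (π (ι c * a))) = ι c * ι (α.act g (π a))
    rw [this, α.act_mul_of_mem_invariants hc', map_mul, hc c hc']
  have h1 : ∀ r, ι (α.act g r) = ∑ i, b i * ι r * d i := fun r => by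
    rw [← hbd]
    change _ = ι (α.act g (π (ι r)))
    rw [hπr]
  -- The component of degree one of this equation.
  have h2 : ∀ r, ι (α.act g r) = ∑ l, ι (α.act l r) * ∑ i, p l⁻¹ (b i) * p l (d i) := by
    intro r
    have hprod : ∀ i, p 1 (b i * ι r * d i) =
        ∑ l, p l⁻¹ (b i) * ι r * p l (d i) := by
      intro i
      conv_lhs => rw [← hp.sum (b i), ← hp.sum (d i)]
      simp only [Finset.sum_mul, Finset.mul_sum, map_sum]
      refine Finset.sum_congr rfl fun l _ => ?_
      rw [Finset.sum_eq_single l⁻¹]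
      · refine hp.same 1 _ ?_
        have := α.mul_mem_C (hp.mem l (d i)) (α.mul_right_mem_C (hp.mem l⁻¹ (b i)) r)
        rwa [mul_inv_cancel] at this
      · intro h _ hh
        refine hp.ne 1 (l * h) (fun h' => hh (eq_inv_of_mul_eq_one_right h'.symm)) _
          (α.mul_mem_C (hp.mem l (d i)) (α.mul_right_mem_C (hp.mem h (b i)) r))
      · simp
    rw [← hp.same 1 _ (map_mem_C_one (α.act g r)), h1, map_sum]
    simp only [hprod]
    rw [Finset.sum_comm]
    refine Finset.sum_congr rfl fun l _ => ?_
    rw [Finset.mul_sum]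
    refine Finset.sum_congr rfl fun i _ => ?_
    have := (hp.mem l⁻¹ (b i)).2 r
    rw [inv_inv] at this
    rw [← mul_assoc, this]
  refine ⟨n, fun i => p g⁻¹ (b i), fun i => p g (d i), fun i => hp.mem _ _, fun i => hp.mem _ _, ?_⟩
  have h3 := calc
    ι (α.idem g) = ∑ j, ι (α.act g (x j)) * ι (α.act g (y j)) := by
      simp only [← map_mul, ← map_sum, hxy.1]
    _ = ∑ j, ι (α.act g (x j)) * ∑ l, ι (α.act l (y j)) * ∑ i, p l⁻¹ (b i) * p l (d i) := by
      simp only [← h2]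
    _ = ∑ l, ι (∑ j, α.act g (x j) * α.act l (y j)) * ∑ i, p l⁻¹ (b i) * p l (d i) := by
      simp only [map_sum, map_mul, Finset.sum_mul (Finset.univ : Finset (Fin m)), Finset.mul_sum,
        ← mul_assoc]
      rw [Finset.sum_comm]
    _ = ι (α.idem g) * ∑ i, p g⁻¹ (b i) * p g (d i) := by
      simp only [hxy.sum_eq]
      rw [Finset.sum_eq_single g]
      · rw [if_pos rfl]
      · intro l _ hl
        rw [if_neg hl.symm, map_zero, zero_mul]
      · simp
  rw [h3, Finset.mul_sum]
  refine Finset.sum_congr rfl fun i _ => ?_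
  have := α.idem_mul_of_mem_C (hp.mem g⁻¹ (b i))
  rw [inv_inv] at this
  rw [← mul_assoc, this]

end Algebra

end UnitalPartialAction

namespace UnitalPartialAction

variable {G : Type v} [Group G] {R : Type u} [CommRing R] {α : UnitalPartialAction G R}
variable {A : Type u} [Ring A] {ι : R →+* A}

/-! ### Partial invertibility of `C_g` -/

variable (α ι) in
/-- `C_g` as a central `R`-bimodule, with `r · a = r a`. -/
def leftBimod (g : G) : RBimodule R :=
  RBimodule.ofActions (α.C ι g) (α.leftAct ι g) (α.leftAct ι g) fun r s a =>
    Subtype.ext (by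
      change ι r * (ι s * a.1) = ι s * (ι r * a.1)
      rw [← mul_assoc, ← mul_assoc, ← map_mul, ← map_mul, mul_comm])

namespace IsPartiallyStrong

variable (h : α.IsPartiallyStrong ι)
include h

lemma exists_map_eq_mul {g : G} {a b : A} (ha : a ∈ α.C ι g) (hb : b ∈ α.C ι g⁻¹) :
    ∃ r, ι r = b * a := by
  refine h.exists_map_eq _ ?_
  have := α.mul_mem_C ha hb
  rwa [mul_inv_cancel] at this

lemma exists_map_eq_mul' {g : G} {a b : A} (ha : a ∈ α.C ι g) (hb : b ∈ α.C ι g⁻¹) :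
    ∃ r, ι r = a * b := by
  refine h.exists_map_eq _ ?_
  have := α.mul_mem_C hb ha
  rwa [inv_mul_cancel] at this

/-- A dual basis of `C_g` for the action `a ↦ a r`, from `1_{g⁻¹} ∈ C_g C_{g⁻¹}`. The endomorphisms
are the left multiplications by elements of `C_g C_{g⁻¹} ⊆ R`. -/
lemma exists_dualBasis_rightAct (g : G) :
    ∃ (n : ℕ) (m : Fin n → α.C ι g) (s : Fin n → α.C ι g →+ R),
      (∀ i r a, s i (α.rightAct ι g r a) = r * s i a) ∧
      (∀ a, ∑ i, α.rightAct ι g (s i a) (m i) = a) ∧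
      ∀ φ : α.C ι g →+ α.C ι g,
        (∀ r a, φ (α.rightAct ι g r a) = α.rightAct ι g r (φ a)) →
        ∃ t, ∀ a, φ a = α.leftAct ι g t a := by
  obtain ⟨n, u, v, hu, hv, huv⟩ := h.exists_sum_mul_eq g⁻¹
  rw [inv_inv] at hu
  choose s hs using fun i (a : α.C ι g) => h.exists_map_eq_mul a.2 (hv i)
  let s' : Fin n → α.C ι g →+ R := fun i => AddMonoidHom.mk' (s i) fun a b => h.injective (by
    rw [map_add, hs, hs, hs, ← mul_add]; rfl)
  let m : Fin n → α.C ι g := fun i => ⟨u i, hu i⟩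
  have hsum : ∀ a, ∑ i, α.rightAct ι g (s' i a) (m i) = a := fun a => Subtype.ext <| by
    rw [AddSubgroup.val_finsetSum]
    change ∑ i, u i * ι (s i a) = a.1
    simp only [hs, ← mul_assoc]
    rw [← Finset.sum_mul, huv, α.idem_mul_of_mem_C a.2]
  refine ⟨n, m, s', fun i r a => h.injective ?_, hsum, fun φ hφ => ?_⟩
  · change ι (s i _) = ι (r * s i a)
    rw [hs, mul_comm, map_mul, hs, mul_assoc]
    rfl
  · choose t ht using fun i => h.exists_map_eq_mul' (φ (m i)).2 (hv i)
    refine ⟨∑ i, t i, fun a => Subtype.ext ?_⟩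
    conv_lhs => rw [← hsum a, map_sum]
    rw [AddSubgroup.val_finsetSum]
    change _ = ι (∑ i, t i) * a.1
    rw [map_sum, Finset.sum_mul]
    refine Finset.sum_congr rfl fun i _ => ?_
    rw [hφ, ht, mul_assoc, ← hs i a]
    rfl

/-- A dual basis of `C_g` for the action `a ↦ r a`, from `1_g ∈ C_{g⁻¹} C_g`. The endomorphisms
are the right multiplications by elements of `C_{g⁻¹} C_g ⊆ R`. -/
lemma exists_dualBasis_leftAct (g : G) :
    ∃ (n : ℕ) (m : Fin n → α.C ι g) (s : Fin n → α.C ι g →+ R),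
      (∀ i r a, s i (α.leftAct ι g r a) = r * s i a) ∧
      (∀ a, ∑ i, α.leftAct ι g (s i a) (m i) = a) ∧
      ∀ φ : α.C ι g →+ α.C ι g,
        (∀ r a, φ (α.leftAct ι g r a) = α.leftAct ι g r (φ a)) →
        ∃ t, ∀ a, φ a = α.rightAct ι g t a := by
  obtain ⟨n, v, u, hv, hu, hvu⟩ := h.exists_sum_mul_eq g
  choose s hs using fun i (a : α.C ι g) => h.exists_map_eq_mul' a.2 (hv i)
  let s' : Fin n → α.C ι g →+ R := fun i => AddMonoidHom.mk' (s i) fun a b => h.injective (by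
    rw [map_add, hs, hs, hs, ← add_mul]; rfl)
  let m : Fin n → α.C ι g := fun i => ⟨u i, hu i⟩
  have hsum : ∀ a, ∑ i, α.leftAct ι g (s' i a) (m i) = a := fun a => Subtype.ext <| by
    rw [AddSubgroup.val_finsetSum]
    change ∑ i, ι (s i a) * u i = a.1
    simp only [hs, mul_assoc]
    rw [← Finset.mul_sum, hvu, mul_idem_of_mem_C a.2]
  refine ⟨n, m, s', fun i r a => h.injective ?_, hsum, fun φ hφ => ?_⟩
  · change ι (s i _) = ι (r * s i a)
    rw [hs, map_mul, hs, ← mul_assoc]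
    rfl
  · choose t ht using fun i => h.exists_map_eq_mul (φ (m i)).2 (hv i)
    refine ⟨∑ i, t i, fun a => Subtype.ext ?_⟩
    conv_lhs => rw [← hsum a, map_sum]
    rw [AddSubgroup.val_finsetSum]
    change _ = a.1 * ι (∑ i, t i)
    rw [map_sum, Finset.mul_sum]
    refine Finset.sum_congr rfl fun i _ => ?_
    rw [hφ, ht, ← mul_assoc, ← hs i a]
    rfl

omit h in
lemma leftAct_eq_rightAct (g : G) (r : R) (a : α.C ι g) :
    α.leftAct ι g r a = α.rightAct ι g (α.act g r) a :=
  Subtype.ext (map_mul_of_mem_C a.2 r)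

omit h in
lemma rightAct_eq_leftAct (g : G) (r : R) (a : α.C ι g) :
    α.rightAct ι g r a = α.leftAct ι g (α.act g⁻¹ r) a :=
  Subtype.ext (a.2.2 r).symm

lemma cBimod_isPartiallyInvertible (g : G) : (α.cBimod ι g).IsPartiallyInvertible := by
  obtain ⟨n, m, s, h1, h2, h3⟩ := h.exists_dualBasis_rightAct g
  refine RBimodule.isPartiallyInvertible_of_central (P := α.cBimod ι g) (fun _ _ => rfl) m s h1 h2
    fun φ hφ => ?_
  obtain ⟨t, ht⟩ := h3 φ hφ
  exact ⟨α.act g t, fun a => (ht a).trans (leftAct_eq_rightAct g t a)⟩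

lemma leftBimod_isPartiallyInvertible (g : G) : (α.leftBimod ι g).IsPartiallyInvertible := by
  obtain ⟨n, m, s, h1, h2, h3⟩ := h.exists_dualBasis_leftAct g
  refine RBimodule.isPartiallyInvertible_of_central (P := α.leftBimod ι g) (fun _ _ => rfl) m s
    h1 h2 fun φ hφ => ?_
  obtain ⟨t, ht⟩ := h3 φ hφ
  exact ⟨α.act g⁻¹ t, fun a => (ht a).trans (rightAct_eq_leftAct g t a)⟩

lemma gammaBimod_isPartiallyInvertible (g : G) : (α.gammaBimod ι g).IsPartiallyInvertible := by
  obtain ⟨n, m, s, h1, h2, h3⟩ := h.exists_dualBasis_rightAct g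
  obtain ⟨n', m', s', h1', h2', h3'⟩ := h.exists_dualBasis_leftAct g
  exact RBimodule.isPartiallyInvertible_of_dualBasis (P := α.gammaBimod ι g) m s h1 h2 m' s' h1' h2'
    h3' h3

end IsPartiallyStrong

end UnitalPartialAction

namespace UnitalPartialAction

variable {G : Type v} [Group G] {R : Type u} [CommRing R] {α : UnitalPartialAction G R}
variable {A : Type u} [Ring A] {ι : R →+* A}

/-! ### Tensor products of the bimodules `C_g` -/

lemma mul_mem_C_of_eq {g l k : G} (hk : g * l = k) {a b : A} (ha : a ∈ α.C ι g)
    (hb : b ∈ α.C ι l) : b * a ∈ α.C ι k :=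
  hk ▸ α.mul_mem_C ha hb

/-- The inclusion of `e Γ_k` in `A`. -/
def cutVal (e : R) (k : G) : ((α.gammaBimod ι k).cut e).carrier →+ A :=
  (α.C ι k).subtype.comp ((α.gammaBimod ι k).cutSubmodule e).subtype.toAddMonoidHom

lemma cutVal_injective (e : R) (k : G) :
    Function.Injective (cutVal (α := α) (ι := ι) e k) :=
  fun _ _ h => Subtype.ext (Subtype.ext h)

lemma gammaBimod_cut_val {e : R} {k : G} (w : (α.gammaBimod ι k).cutSubmodule e) :
    w.1.1 * ι e = w.1.1 :=
  congrArg (α.C ι k).subtype (show (e • w.1 : (α.gammaBimod ι k).carrier) = w.1 from w.2)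

lemma cBimod_cut_val {e : R} {k : G} (w : (α.cBimod ι k).cutSubmodule e) :
    w.1.1 * ι e = w.1.1 :=
  congrArg (α.C ι k).subtype (show (e • w.1 : (α.cBimod ι k).carrier) = w.1 from w.2)

/-- `[Γ_g] = [C_g] Θ(g)`. -/
lemma cBimod_tensor_thetaBimod_iso (g : G) :
    ((α.cBimod ι g).tensor (α.thetaBimod g)).Iso (α.gammaBimod ι g) := by
  refine RBimodule.tensor_iso (M := α.cBimod ι g) (N := α.thetaBimod g) (P := α.gammaBimod ι g)
    (κ := Unit) (fun (a : α.C ι g) (d : α.D g) => α.rightAct ι g d a)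
    (fun a b d => map_add (α.rightAct ι g d.1) a b)
    (fun a d d' => DFunLike.congr_fun (map_add (α.rightAct ι g) d.1 d'.1) a)
    (fun r a d => Subtype.ext ?_) (fun r a d => Subtype.ext ?_) (fun r a d => Subtype.ext ?_)
    (fun _ a => a) (fun _ _ => (⟨α.idem g, Ideal.mem_span_singleton_self _⟩ : α.D g))
    (fun _ a b => RBimodule.add_tmul (M := α.cBimod ι g) (N := α.thetaBimod g) a b _)
    (fun a d => (Fintype.sum_unique _).trans ?_)
    (fun a => (Fintype.sum_unique _).trans (Subtype.ext (mul_idem_of_mem_C a.2)))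
  · change a.1 * ι r * ι d.1 = a.1 * ι d.1 * ι r
    rw [mul_assoc, mul_assoc, ← map_mul, ← map_mul, mul_comm]
  · change a.1 * ι r * ι d.1 = a.1 * ι (r * d.1)
    rw [mul_assoc, map_mul]
  · change a.1 * ι (α.act g r * d.1) = ι r * (a.1 * ι d.1)
    rw [map_mul, ← mul_assoc, ← mul_assoc, map_mul_of_mem_C a.2]
  · refine (RBimodule.op_smul_tmul_eq (M := α.cBimod ι g) (N := α.thetaBimod g) d.1 a _).trans
      (congrArg (RBimodule.tmul (M := α.cBimod ι g) (N := α.thetaBimod g) a) (Subtype.ext ?_))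
    exact α.mem_D.1 d.2

namespace IsPartiallyStrong

variable (h : α.IsPartiallyStrong ι)
include h

/-- `Γ_1 ≅ R`. -/
lemma gammaBimod_one_iso : (RBimodule.central R).Iso (α.gammaBimod ι 1) := by
  let f : R →ₗ[R] (α.gammaBimod ι 1).carrier :=
    { toFun := fun r => (⟨ι r, map_mem_C_one r⟩ : α.C ι 1)
      map_add' := fun r s => Subtype.ext (map_add ι r s)
      map_smul' := fun r s => Subtype.ext ((congrArg ι (mul_comm r s)).trans (map_mul ι s r)) }
  refine ⟨LinearEquiv.ofBijective f ⟨fun r s hrs => h.injective (congrArg Subtype.val hrs),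
    fun a => ?_⟩, fun r s => Subtype.ext (map_mul ι r s)⟩
  obtain ⟨r, hr⟩ := h.exists_map_eq a.1 a.2
  exact ⟨r, Subtype.ext hr⟩

/-- `e Γ_1 ≅ R e`. -/
lemma gammaBimod_one_cut_iso {e : R} (he : IsIdempotentElem e) {k : G} (hk : 1 = k) :
    (RBimodule.central (Ideal.span {e} : Ideal R)).Iso ((α.gammaBimod ι k).cut e) := by
  subst hk
  have hI : ∀ d, d ∈ (Ideal.span {e} : Ideal R) ↔ d * e = d := by
    intro d
    rw [Ideal.mem_span_singleton']
    constructor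
    · rintro ⟨y, rfl⟩
      rw [mul_assoc, he.eq]
    · exact fun hd => ⟨d, hd⟩
  let f : (Ideal.span {e} : Ideal R) →ₗ[R] ((α.gammaBimod ι 1).cut e).carrier :=
    { toFun := fun d => (⟨(⟨ι d.1, map_mem_C_one d.1⟩ : α.C ι 1), Subtype.ext (by
        change ι d.1 * ι e = ι d.1
        rw [← map_mul, (hI d.1).1 d.2])⟩ : (α.gammaBimod ι 1).cutSubmodule e)
      map_add' := fun r s => Subtype.ext (Subtype.ext (map_add ι r.1 s.1))
      map_smul' := fun r s => Subtype.ext (Subtype.ext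
        ((congrArg ι (mul_comm r s.1)).trans (map_mul ι s.1 r))) }
  refine ⟨LinearEquiv.ofBijective f ⟨fun r s hrs => Subtype.ext (h.injective
    (congrArg (cutVal e 1) hrs)), fun a => ?_⟩,
    fun r s => Subtype.ext (Subtype.ext (map_mul ι r s.1))⟩
  obtain ⟨r, hr⟩ := h.exists_map_eq a.1.1 a.1.2
  refine ⟨⟨r, (hI r).2 (h.injective ?_)⟩, Subtype.ext (Subtype.ext hr)⟩
  rw [map_mul, hr]
  exact gammaBimod_cut_val a

/-- `e Γ_g ⊗ Γ_l ≅ e 1_g Γ_{gl}` by `w ⊗ z ↦ z w`, with inverse `c ↦ ∑ u_i e ⊗ c v_i`, where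
`∑ v_i u_i = 1_g`. -/
lemma cut_tensor_gammaBimod_iso {e : R} (he : IsIdempotentElem e) {g l k : G} (hk : g * l = k) :
    (((α.gammaBimod ι g).cut e).tensor (α.gammaBimod ι l)).Iso
      ((α.gammaBimod ι k).cut (e * α.idem g)) := by
  obtain ⟨n, v, u, hv, hu, hvu⟩ := h.exists_sum_mul_eq g
  have hcut : ∀ w : (α.gammaBimod ι g).cutSubmodule e, w.1.1 * ι e = w.1.1 :=
    gammaBimod_cut_val
  have hcut' : ∀ c : (α.gammaBimod ι k).cutSubmodule (e * α.idem g),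
      c.1.1 * ι (e * α.idem g) = c.1.1 :=
    gammaBimod_cut_val
  have hl : g⁻¹ * k = l := by rw [← hk, inv_mul_cancel_left]
  let U : Fin n → ((α.gammaBimod ι g).cut e).carrier := fun i =>
    (⟨(⟨u i * ι e, α.mul_right_mem_C (hu i) e⟩ : α.C ι g), Subtype.ext (by
      change u i * ι e * ι e = u i * ι e
      rw [mul_assoc, ← map_mul, he.eq])⟩ : (α.gammaBimod ι g).cutSubmodule e)
  let T : Fin n → (α.gammaBimod ι k).cutSubmodule (e * α.idem g) →+ α.C ι l := fun i =>
    AddMonoidHom.mk' (fun c => ⟨c.1.1 * v i, mul_mem_C_of_eq hl (hv i) c.1.2⟩)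
      fun c c' => Subtype.ext (add_mul c.1.1 c'.1.1 (v i))
  refine RBimodule.tensor_iso (M := (α.gammaBimod ι g).cut e) (N := α.gammaBimod ι l)
    (P := (α.gammaBimod ι k).cut (e * α.idem g)) (κ := Fin n)
    (fun (w : (α.gammaBimod ι g).cutSubmodule e) (z : α.C ι l) =>
      (⟨(⟨z.1 * w.1.1, mul_mem_C_of_eq hk w.1.2 z.2⟩ : α.C ι k), Subtype.ext ?_⟩ :
        (α.gammaBimod ι k).cutSubmodule (e * α.idem g)))
    (fun w w' z => Subtype.ext (Subtype.ext (mul_add z.1 w.1.1 w'.1.1)))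
    (fun w z z' => Subtype.ext (Subtype.ext (add_mul z.1 z'.1 w.1.1)))
    (fun r w z => Subtype.ext (Subtype.ext (mul_assoc z.1 w.1.1 (ι r)).symm))
    (fun r w z => Subtype.ext (Subtype.ext (mul_assoc z.1 (ι r) w.1.1).symm))
    (fun r w z => Subtype.ext (Subtype.ext (mul_assoc (ι r) z.1 w.1.1)))
    (fun i _ => U i)
    (fun i c => T i c)
    (fun i c c' => (congrArg (RBimodule.tmul (M := (α.gammaBimod ι g).cut e)
      (N := α.gammaBimod ι l) (U i)) (map_add (T i) c c')).trans
      (RBimodule.tmul_add (N := α.gammaBimod ι l) (U i) _ _)) (fun w z => ?_)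
    (fun c => cutVal_injective _ _ ?_)
  · change z.1 * w.1.1 * ι (e * α.idem g) = z.1 * w.1.1
    rw [map_mul, mul_assoc, ← mul_assoc w.1.1, hcut, mul_idem_of_mem_C w.1.2]
  · choose ρ hρ using fun i => h.exists_map_eq_mul' w.1.2 (hv i)
    have hw : ∑ i, (op (ρ i) • U i : ((α.gammaBimod ι g).cut e).carrier) = w := by
      refine cutVal_injective _ _ ((map_sum (cutVal e g) _ _).trans ?_)
      change ∑ i, ι (ρ i) * (u i * ι e) = w.1.1
      simp only [hρ, ← mul_assoc]
      rw [← Finset.sum_mul]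
      simp only [mul_assoc w.1.1]
      rw [← Finset.mul_sum, hvu, mul_idem_of_mem_C w.1.2]
      exact hcut w
    conv_rhs => rw [← hw]
    refine Eq.trans (Finset.sum_congr rfl fun i _ => ?_) (RBimodule.sum_tmul _ _ _).symm
    refine Eq.trans (congrArg (RBimodule.tmul (M := (α.gammaBimod ι g).cut e)
      (N := α.gammaBimod ι l) (U i)) (Subtype.ext ?_)) (RBimodule.op_smul_tmul_eq (ρ i) _ _).symm
    change z.1 * w.1.1 * v i = z.1 * ι (ρ i)
    rw [hρ, mul_assoc]
  · refine (map_sum (cutVal (e * α.idem g) k) _ _).trans ?_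
    change ∑ i, c.1.1 * v i * (u i * ι e) = c.1.1
    simp only [← mul_assoc]
    rw [← Finset.sum_mul]
    simp only [mul_assoc c.1.1]
    rw [← Finset.mul_sum, hvu, mul_assoc, ← map_mul, mul_comm (α.idem g)]
    exact hcut' c

/-- `C_g ⊗ C_{g⁻¹} ≅ D_g` for the central structures `a r` on `C_g` and `r a` on `C_{g⁻¹}`. -/
lemma cBimod_tensor_leftBimod_iso (g : G) :
    ((α.cBimod ι g).tensor (α.leftBimod ι g⁻¹)).Iso
      (RBimodule.central (Ideal.span {α.idem g} : Ideal R)) := by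
  refine RBimodule.Iso.trans ?_ (h.gammaBimod_one_cut_iso (α.idem_mul_idem g) rfl).symm
  obtain ⟨n, v, u, hv, hu, hvu⟩ := h.exists_sum_mul_eq g
  let V : Fin n → (α.leftBimod ι g⁻¹).carrier := fun i => (⟨v i, hv i⟩ : α.C ι g⁻¹)
  let T : Fin n → (α.gammaBimod ι 1).cutSubmodule (α.idem g) →+ α.C ι g := fun i =>
    AddMonoidHom.mk' (fun d => ⟨u i * d.1.1, mul_mem_C_of_eq (one_mul g) d.1.2 (hu i)⟩)
      fun d d' => Subtype.ext (mul_add (u i) d.1.1 d'.1.1)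
  have hcut : ∀ c : (α.gammaBimod ι 1).cutSubmodule (α.idem g), c.1.1 * ι (α.idem g) = c.1.1 :=
    gammaBimod_cut_val
  -- The inverse is `d ↦ ∑ u_i d ⊗ v_i`.
  refine RBimodule.tensor_iso (M := α.cBimod ι g) (N := α.leftBimod ι g⁻¹)
    (P := (α.gammaBimod ι 1).cut (α.idem g)) (κ := Fin n)
    (fun (a : α.C ι g) (b : α.C ι g⁻¹) =>
      (⟨(⟨b.1 * a.1, mul_mem_C_of_eq (mul_inv_cancel g) a.2 b.2⟩ : α.C ι 1), Subtype.ext ?_⟩ :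
        (α.gammaBimod ι 1).cutSubmodule (α.idem g)))
    (fun a a' b => Subtype.ext (Subtype.ext (mul_add b.1 a.1 a'.1)))
    (fun a b b' => Subtype.ext (Subtype.ext (add_mul b.1 b'.1 a.1)))
    (fun r a b => Subtype.ext (Subtype.ext (mul_assoc b.1 a.1 (ι r)).symm))
    (fun r a b => Subtype.ext (Subtype.ext ?_))
    (fun r a b => Subtype.ext (Subtype.ext (mul_assoc (ι r) b.1 a.1)))
    (fun i d => T i d) (fun i _ => V i)
    (fun i d d' => (congrArg (fun x : α.C ι g => RBimodule.tmul (M := α.cBimod ι g)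
      (N := α.leftBimod ι g⁻¹) x (V i)) (map_add (T i) d d')).trans
      (RBimodule.add_tmul (M := α.cBimod ι g) _ _ (V i))) (fun a b => ?_)
    (fun c => cutVal_injective _ _ ?_)
  · change b.1 * a.1 * ι (α.idem g) = b.1 * a.1
    rw [mul_assoc, mul_idem_of_mem_C a.2]
  · change b.1 * (a.1 * ι r) = ι r * b.1 * a.1
    obtain ⟨s, hs⟩ := h.exists_map_eq_mul a.2 b.2
    rw [← mul_assoc, mul_assoc (ι r), ← hs, ← map_mul, mul_comm, map_mul]
  · choose σ hσ using fun i => h.exists_map_eq_mul' (hu i) b.2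
    have hb : ∑ i, (α.act g (σ i) • V i : (α.leftBimod ι g⁻¹).carrier) = b := by
      refine Subtype.ext ((map_sum (α.C ι g⁻¹).subtype _ _).trans ?_)
      change ∑ i, ι (α.act g (σ i)) * v i = b.1
      have h1 : ∀ i, ι (α.act g (σ i)) * v i = v i * u i * b.1 := fun i => by
        have := (hv i).2 (σ i)
        rw [inv_inv] at this
        rw [this, hσ, mul_assoc]
      have h2 := α.idem_mul_of_mem_C b.2
      rw [inv_inv] at h2
      simp only [h1]
      rw [← Finset.sum_mul, hvu, h2]
    conv_rhs => rw [← hb]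
    refine Eq.trans (Finset.sum_congr rfl fun i _ => ?_) (RBimodule.tmul_sum _ _ _).symm
    refine Eq.trans (congrArg (fun x : α.C ι g => RBimodule.tmul (M := α.cBimod ι g)
      (N := α.leftBimod ι g⁻¹) x (V i)) (Subtype.ext ?_))
      (RBimodule.op_smul_tmul_eq (α.act g (σ i)) _ _)
    change u i * (b.1 * a.1) = a.1 * ι (α.act g (σ i))
    rw [← map_mul_of_mem_C a.2, hσ, mul_assoc]
  · refine (map_sum (cutVal (α.idem g) 1) _ _).trans ?_
    change ∑ i, v i * (u i * c.1.1) = c.1.1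
    simp only [← mul_assoc]
    rw [← Finset.sum_mul, hvu]
    exact (mem_C_one.1 c.1.2 _).trans (hcut c)

/-- `(1_{g⁻¹} C_l)_g ⊗ C_g ≅ 1_g C_{gl}` by `p ⊗ a ↦ p a`, with inverse
`c ↦ ∑ c v_i ⊗ u_i`, where `∑ v_i u_i = 1_g`. -/
lemma twist_tensor_cBimod_iso (g l : G) :
    ((α.twist g ((α.cBimod ι l).cut (α.idem g⁻¹))).tensor (α.cBimod ι g)).Iso
      ((α.cBimod ι (g * l)).cut (α.idem g)) := by
  obtain ⟨n, v, u, hv, hu, hvu⟩ := h.exists_sum_mul_eq g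
  let Q := (α.cBimod ι l).cut (α.idem g⁻¹)
  let U : Fin n → (α.cBimod ι g).carrier := fun i => (⟨u i, hu i⟩ : α.C ι g)
  have hcut : ∀ c : (α.cBimod ι (g * l)).cutSubmodule (α.idem g),
      c.1.1 * ι (α.idem g) = c.1.1 :=
    cBimod_cut_val
  have hQ : ∀ p : (α.cBimod ι l).cutSubmodule (α.idem g⁻¹), p.1.1 * ι (α.idem g⁻¹) = p.1.1 :=
    cBimod_cut_val
  let q (a : A) (ha : a ∈ α.C ι l) (ha' : a * ι (α.idem g⁻¹) = a) : α.cut g Q :=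
    ⟨(⟨(⟨a, ha⟩ : α.C ι l), Subtype.ext ha'⟩ : (α.cBimod ι l).cutSubmodule (α.idem g⁻¹)),
      Subtype.ext (Subtype.ext ha'), Subtype.ext (Subtype.ext ha')⟩
  let T : Fin n → (α.cBimod ι (g * l)).cutSubmodule (α.idem g) →+ α.cut g Q := fun i =>
    AddMonoidHom.mk' (fun c => q (c.1.1 * v i)
        (mul_mem_C_of_eq (inv_mul_cancel_left g l) (hv i) c.1.2)
        (by rw [mul_assoc, mul_idem_of_mem_C (hv i)]))
      fun c c' => Subtype.ext (Subtype.ext (Subtype.ext (add_mul c.1.1 c'.1.1 (v i))))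
  refine RBimodule.tensor_iso (M := α.twist g Q) (N := α.cBimod ι g)
    (P := (α.cBimod ι (g * l)).cut (α.idem g)) (κ := Fin n)
    (fun (p : α.cut g Q) (a : α.C ι g) =>
      (⟨(⟨p.1.1.1 * a.1, α.mul_mem_C a.2 p.1.1.2⟩ : α.C ι (g * l)), Subtype.ext ?_⟩ :
        (α.cBimod ι (g * l)).cutSubmodule (α.idem g)))
    (fun p p' a => Subtype.ext (Subtype.ext (add_mul p.1.1.1 p'.1.1.1 a.1)))
    (fun p a a' => Subtype.ext (Subtype.ext (mul_add p.1.1.1 a.1 a'.1)))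
    (fun r p a => Subtype.ext (Subtype.ext ?_))
    (fun r p a => Subtype.ext (Subtype.ext ?_))
    (fun r p a => Subtype.ext (Subtype.ext (mul_assoc p.1.1.1 a.1 (ι r)).symm))
    (fun i c => T i c) (fun i _ => U i)
    (fun i c c' => (congrArg (fun x : α.cut g Q => RBimodule.tmul (M := α.twist g Q)
      (N := α.cBimod ι g) x (U i)) (map_add (T i) c c')).trans
      (RBimodule.add_tmul (M := α.twist g Q) _ _ (U i))) (fun p a => ?_)
    (fun c => Subtype.ext (Subtype.ext ?_))
  · change p.1.1.1 * a.1 * ι (α.idem g) = p.1.1.1 * a.1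
    rw [mul_assoc, mul_idem_of_mem_C a.2]
  · change p.1.1.1 * ι (α.act g⁻¹ r) * a.1 = p.1.1.1 * a.1 * ι r
    rw [mul_assoc, a.2.2, mul_assoc]
  · change p.1.1.1 * ι (α.act g⁻¹ r) * a.1 = p.1.1.1 * (a.1 * ι r)
    rw [mul_assoc, a.2.2]
  · choose ρ hρ using fun i => h.exists_map_eq_mul' a.2 (hv i)
    have ha : ∑ i, (α.act g (ρ i) • U i : (α.cBimod ι g).carrier) = a := by
      refine Subtype.ext ((map_sum (α.C ι g).subtype _ _).trans ?_)
      change ∑ i, u i * ι (α.act g (ρ i)) = a.1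
      have h1 : ∀ i, u i * ι (α.act g (ρ i)) = a.1 * (v i * u i) := fun i => by
        rw [← map_mul_of_mem_C (hu i), hρ, mul_assoc]
      simp only [h1]
      rw [← Finset.mul_sum, hvu, mul_idem_of_mem_C a.2]
    conv_rhs => rw [← ha]
    refine Eq.trans (Finset.sum_congr rfl fun i _ => ?_) (RBimodule.tmul_sum _ _ _).symm
    refine Eq.trans (congrArg (fun x : α.cut g Q => RBimodule.tmul (M := α.twist g Q)
      (N := α.cBimod ι g) x (U i)) (Subtype.ext (Subtype.ext (Subtype.ext ?_))))
      (RBimodule.op_smul_tmul_eq (α.act g (ρ i)) _ _)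
    change p.1.1.1 * a.1 * v i = p.1.1.1 * ι (α.act g⁻¹ (α.act g (ρ i)))
    rw [α.act_act, inv_mul_cancel, α.act_one_left, mul_comm (ρ i), map_mul, ← mul_assoc, hQ p.1, hρ,
      mul_assoc]
  · refine (map_sum ((α.C ι (g * l)).subtype.comp
      ((α.cBimod ι (g * l)).cutSubmodule (α.idem g)).subtype.toAddMonoidHom) _ _).trans ?_
    change ∑ i, c.1.1 * v i * u i = c.1.1
    simp only [mul_assoc]
    rw [← Finset.mul_sum, hvu]
    exact hcut c

end IsPartiallyStrong

end UnitalPartialAction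

lemma BimodClass.mk_eq_mk {R : Type u} [CommRing R] {P Q : RBimodule R} (h : P.Iso Q) :
    BimodClass.mk P = BimodClass.mk Q :=
  Quotient.sound h

namespace UnitalPartialAction

variable {G : Type v} [Group G] {R : Type u} [CommRing R] {α : UnitalPartialAction G R}
variable {A : Type u} [Ring A] {ι : R →+* A}

/-! ### The cocycle, the partial representation and the factor set -/

namespace IsPartiallyStrong

variable (h : α.IsPartiallyStrong ι)
include h

lemma isOneCocycle : α.IsOneCocycle (α.fA ι) where
  isUnit g := by
    have hX : ∀ P : RBimodule R, P.IsPartiallyInvertible →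
        (∀ (r : R) (p : P.carrier), op r • p = r • p) → (∀ p : P.carrier, α.idem g • p = p) →
        BimodClass.mk P ∈ α.X g := fun P hP hc hg =>
      ⟨BimodClass.mk P, ⟨P, hP, fun r _ p => (hc r p).symm, rfl⟩,
        (BimodClass.mk_eq_mk ((RBimodule.tensor_ideal_iso_cut hc (α.idem_mul_idem g)).trans
          (RBimodule.cut_iso_self hg))).symm⟩
    refine ⟨hX _ (h.cBimod_isPartiallyInvertible g) (fun _ _ => rfl)
      fun a => Subtype.ext (mul_idem_of_mem_C a.2), BimodClass.mk (α.leftBimod ι g⁻¹),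
      hX _ (h.leftBimod_isPartiallyInvertible g⁻¹) (fun _ _ => rfl) fun a => Subtype.ext ?_,
      BimodClass.mk_eq_mk (h.cBimod_tensor_leftBimod_iso g),
      BimodClass.mk_eq_mk ((RBimodule.tensor_comm_of_central (fun _ _ => rfl) fun _ _ => rfl).trans
        (h.cBimod_tensor_leftBimod_iso g))⟩
    have := α.idem_mul_of_mem_C a.2
    rwa [inv_inv] at this
  cocycle g l := BimodClass.mk_eq_mk <|
    (RBimodule.Iso.tensor (α.twist_congr g (RBimodule.tensor_ideal_iso_cut (fun _ _ => rfl)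
      (α.idem_mul_idem g⁻¹))) (RBimodule.Iso.refl _)).trans <|
    (h.twist_tensor_cBimod_iso g l).trans
      (RBimodule.tensor_ideal_iso_cut (fun _ _ => rfl) (α.idem_mul_idem g)).symm

/-- `Γ_g ⊗ Γ_l ≅ 1_g Γ_{gl}`. -/
lemma gammaBimod_tensor_gammaBimod_iso {g l k : G} (hk : g * l = k) :
    ((α.gammaBimod ι g).tensor (α.gammaBimod ι l)).Iso
      ((α.gammaBimod ι k).cut (α.idem g)) := by
  have h1 := h.cut_tensor_gammaBimod_iso IsIdempotentElem.one hk
  rw [one_mul] at h1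
  exact ((RBimodule.cut_iso_self (one_smul R)).symm.tensor (RBimodule.Iso.refl _)).trans h1

lemma isUnitalPartialRep : IsUnitalPartialRep α.idem (α.gammaBimod ι) where
  mem_picS g := ⟨_, h.gammaBimod_isPartiallyInvertible g, rfl⟩
  partialRep :=
    { map_one := BimodClass.mk_eq_mk h.gammaBimod_one_iso.symm
      -- Both sides are `1_g 1_{gl} Γ_g = 1_{gl} Γ_g`.
      mul_mul_inv := fun g l => BimodClass.mk_eq_mk <|
        (RBimodule.Iso.tensor (h.gammaBimod_tensor_gammaBimod_iso rfl)
          (RBimodule.Iso.refl _)).trans <|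
        (h.cut_tensor_gammaBimod_iso (α.idem_mul_idem g) (mul_inv_cancel_right g l)).trans <|
        (RBimodule.cut_iso_cut fun a => by
          have ha : α.idem g • a = a := Subtype.ext (mul_idem_of_mem_C a.2)
          rw [mul_comm, mul_smul, ha]).trans
        (h.gammaBimod_tensor_gammaBimod_iso (mul_inv_cancel_right g l)).symm
      -- Both sides are `1_{g⁻¹} Γ_l`.
      inv_mul_mul := fun g l => BimodClass.mk_eq_mk <|
        (RBimodule.Iso.tensor (h.gammaBimod_tensor_gammaBimod_iso (inv_mul_cancel g))
          (RBimodule.Iso.refl _)).trans <|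
        (h.cut_tensor_gammaBimod_iso (α.idem_mul_idem g⁻¹) (one_mul l)).trans <|
        (RBimodule.cut_iso_cut fun a => by
          rw [α.idem_one, mul_one]).trans
        (h.gammaBimod_tensor_gammaBimod_iso (inv_mul_cancel_left g l)).symm }
  idem := α.idem_mul_idem
  mul_inv g := BimodClass.mk_eq_mk <|
    (h.gammaBimod_tensor_gammaBimod_iso (mul_inv_cancel g)).trans
      (h.gammaBimod_one_cut_iso (α.idem_mul_idem g) rfl).symm

/-- Any `x ∈ Γ_g ⊗ Γ_l` is `∑ u_i ⊗ c v_i`, where `c` is its image in `Γ_{gl}` and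
`∑ v_i u_i = 1_g`. -/
lemma gammaMul_injective (g l : G) : Function.Injective (α.gammaMul ι g l) := by
  obtain ⟨n, v, u, hv, hu, hvu⟩ := h.exists_sum_mul_eq g
  let U : Fin n → (α.gammaBimod ι g).carrier := fun i => (⟨u i, hu i⟩ : α.C ι g)
  let T : Fin n → (α.gammaBimod ι (g * l)).carrier →+ (α.gammaBimod ι l).carrier := fun i =>
    AddMonoidHom.mk' (fun c : α.C ι (g * l) =>
        (⟨c.1 * v i, mul_mem_C_of_eq (inv_mul_cancel_left g l) (hv i) c.2⟩ : α.C ι l))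
      fun c c' => Subtype.ext (add_mul c.1 c'.1 (v i))
  let S : (α.gammaBimod ι (g * l)).carrier →+
      ((α.gammaBimod ι g).tensor (α.gammaBimod ι l)).carrier :=
    ∑ i, (RBimodule.tmulHom _ _ (U i)).comp (T i)
  refine Function.LeftInverse.injective (g := S) fun x => ?_
  induction x using RBimodule.tensor_induction with
  | zero => rw [map_zero, map_zero]
  | add x y hx hy => rw [map_add, map_add, hx, hy]
  | tmul w z =>
    have hS : ∀ c, S c = ∑ i, RBimodule.tmul (U i) (T i c) := fun c => by
      rw [AddMonoidHom.finsetSum_apply]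
      rfl
    choose ρ hρ using fun i => h.exists_map_eq_mul' w.2 (hv i)
    have hw : ∑ i, (op (ρ i) • U i : (α.gammaBimod ι g).carrier) = w := by
      refine Subtype.ext ((map_sum (α.C ι g).subtype _ _).trans ?_)
      change ∑ i, ι (ρ i) * u i = w.1
      simp only [hρ, mul_assoc]
      rw [← Finset.mul_sum, hvu, mul_idem_of_mem_C w.2]
    rw [hS]
    conv_rhs => rw [← hw]
    rw [RBimodule.sum_tmul]
    refine Finset.sum_congr rfl fun i _ => ?_
    rw [RBimodule.op_smul_tmul_eq]
    refine congrArg (RBimodule.tmul (U i)) (Subtype.ext ?_)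
    change z.1 * w.1 * v i = z.1 * ι (ρ i)
    rw [hρ, mul_assoc]

lemma isFactorSet : IsFactorSet α.idem (α.gammaBimod ι) (α.gammaMul ι) where
  map_op_smul g l r x := by
    induction x using RBimodule.tensor_induction with
    | zero => rw [smul_zero, map_zero, smul_zero]
    | add x y hx hy => rw [smul_add, map_add, map_add, smul_add, hx, hy]
    | tmul w z => exact Subtype.ext (mul_assoc (ι r) z.1 w.1)
  injective := h.gammaMul_injective
  range_eq g l := by
    ext c
    constructor
    · rintro ⟨x, rfl⟩
      refine ⟨α.gammaMul ι g l x, ?_⟩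
      rw [← map_smul]
      congr 1
      induction x using RBimodule.tensor_induction with
      | zero => rw [smul_zero]
      | add x y hx hy => rw [smul_add, hx, hy]
      | tmul w z =>
        rw [RBimodule.smul_tmul]
        exact congrArg (fun w => RBimodule.tmul w z) (Subtype.ext (mul_idem_of_mem_C w.2))
    · rintro ⟨c, rfl⟩
      obtain ⟨n, v, u, hv, hu, hvu⟩ := h.exists_sum_mul_eq g
      refine ⟨∑ i, RBimodule.tmul (M := α.gammaBimod ι g) (N := α.gammaBimod ι l)
        (⟨u i, hu i⟩ : α.C ι g)
        (⟨c.1 * v i, mul_mem_C_of_eq (inv_mul_cancel_left g l) (hv i) c.2⟩ : α.C ι l), ?_⟩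
      rw [map_sum]
      refine Subtype.ext ((map_sum (α.C ι (g * l)).subtype _ _).trans ?_)
      change ∑ i, c.1 * v i * u i = c.1 * ι (α.idem g)
      simp only [mul_assoc]
      rw [← Finset.mul_sum, hvu]
  assoc g k l x y z := by
    have key : ∀ {s t : G} (_ : s = t) (a : α.C ι s) (b : α.C ι t), a.1 = b.1 →
        (⟨s, a⟩ : Σ s : G, (α.gammaBimod ι s).carrier) = ⟨t, b⟩ := by
      rintro s _ rfl a b hab
      exact congrArg _ (Subtype.ext hab)
    exact key (mul_assoc g k l) _ _ (mul_assoc z.1 y.1 x.1).symm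

end IsPartiallyStrong

/-- `Δ(Γ)` is anti-isomorphic to `A`. -/
lemma IsDecomposition.algIso [Fintype G] {p : G → A →+ A} (hp : α.IsDecomposition ι p)
    {B : Type*} [Ring B] [Algebra α.invariants B] (j : A ≃+ B)
    (j_mul : ∀ a b, j (a * b) = j b * j a)
    (j_smul : ∀ (c : α.invariants) a, j (a * ι c) = c • j a) :
    CrossedProduct.AlgIso (α.gammaBimod ι) (α.gammaMul ι) α.invariants B := by
  classical
  let val : ∀ g, (α.gammaBimod ι g).carrier →+ A := fun g => (α.C ι g).subtype
  let F : (⨁ g, (α.gammaBimod ι g).carrier) →+ A := DirectSum.toAddMonoid val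
  have val_injective : ∀ g, Function.Injective (val g) := fun g => Subtype.val_injective
  have val_mem : ∀ g a, val g a ∈ α.C ι g := fun g a => a.2
  have hF : ∀ g a, F (DirectSum.of (fun g => (α.gammaBimod ι g).carrier) g a) = val g a :=
    fun g a => DirectSum.toAddMonoid_of val g a
  have hpF : ∀ g x, p g (F x) = val g (x g) := by
    intro g x
    induction x using DirectSum.induction_on with
    | zero => rw [map_zero, map_zero, DirectSum.zero_apply, map_zero]
    | add x y hx hy => rw [map_add, map_add, hx, hy, DirectSum.add_apply, map_add]
    | of l a =>
      rw [hF]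
      by_cases hgl : g = l
      · subst hgl
        rw [hp.same _ _ (val_mem g a), DirectSum.of_eq_same]
      · rw [hp.ne g l hgl _ (val_mem l a), DirectSum.of_eq_of_ne _ _ _ hgl, map_zero]
  have hbij : Function.Bijective F := by
    constructor
    · rw [injective_iff_map_eq_zero]
      intro x hx
      refine DFinsupp.ext fun g => val_injective g ?_
      rw [← hpF, hx, map_zero, DFinsupp.zero_apply, map_zero]
    · intro a
      choose q hq using fun g => (⟨⟨p g a, hp.mem g a⟩, rfl⟩ : ∃ b, val g b = p g a)
      refine ⟨∑ g, DirectSum.of (fun g => (α.gammaBimod ι g).carrier) g (q g), ?_⟩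
      simp only [map_sum, hF, hq, hp.sum]
  have hmul : ∀ x y, F (CrossedProduct.mulHom (α.gammaBimod ι) (α.gammaMul ι) x y) = F y * F x := by
    intro x y
    induction x using DirectSum.induction_on with
    | zero => rw [map_zero, map_zero, mul_zero, AddMonoidHom.zero_apply, map_zero]
    | add x x' hx hx' =>
      rw [map_add, AddMonoidHom.add_apply, map_add, hx, hx', map_add, mul_add]
    | of g a =>
      induction y using DirectSum.induction_on with
      | zero => rw [map_zero, map_zero, zero_mul]
      | add y y' hy hy' => rw [map_add, map_add, hy, hy', map_add, add_mul]
      | of l b =>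
        rw [hF, hF]
        exact (congrArg F (CrossedProduct.of_mul_of (α.gammaBimod ι) (α.gammaMul ι) g l a b)).trans
          (hF _ _)
  have hsmul : ∀ (r : R) x, F (r • x) = F x * ι r := by
    intro r x
    induction x using DirectSum.induction_on with
    | zero => rw [smul_zero, map_zero, zero_mul]
    | add x y hx hy => rw [smul_add, map_add, map_add, add_mul, hx, hy]
    | of g a =>
      rw [← DirectSum.of_smul, hF, hF]
      rfl
  refine ⟨{ (AddEquiv.ofBijective F hbij).trans j with
    map_mul' := fun x y => (congrArg j (hmul x y)).trans (j_mul _ _) }, fun c x => ?_⟩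
  exact (congrArg j (hsmul c x)).trans (j_smul c _)

end UnitalPartialAction

/-! ### Azumaya algebras -/

/-- An endomorphism of an Azumaya algebra is of the form `a ↦ ∑ b_i a d_i`. -/
lemma IsAzumaya.exists_sum_mul_mul {k A : Type*} [CommRing k] [Ring A] [Algebra k A]
    [IsAzumaya k A] (φ : A →ₗ[k] A) :
    ∃ (n : ℕ) (b d : Fin n → A), ∀ a, φ a = ∑ i, b i * a * d i := by
  obtain ⟨t, ht⟩ := (IsAzumaya.bij (R := k) (A := A)).2 φ
  obtain ⟨n, b, d, rfl⟩ := TensorProduct.exists_sum_tmul_eq t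
  refine ⟨n, b, fun i => (d i).unop, fun a => ?_⟩
  rw [← ht, map_sum, LinearMap.sum_apply]
  simp only [AlgHom.mulLeftRight_apply]

/-- A maximal commutative subalgebra is its own centralizer. -/
lemma Subalgebra.mem_of_maximal_commutative {k A : Type*} [CommRing k] [Ring A] [Algebra k A]
    {S : Subalgebra k A}
    (hS : Maximal (fun B : Subalgebra k A => ∀ x ∈ B, ∀ y ∈ B, x * y = y * x) S)
    {a : A} (ha : ∀ s ∈ S, s * a = a * s) : a ∈ S := by
  let B := Algebra.adjoin k (insert a (S : Set A))
  have hcomm : ∀ x ∈ insert a (S : Set A), ∀ y ∈ insert a (S : Set A), x * y = y * x := by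
    rintro x (rfl | hx) y (rfl | hy)
    · rfl
    · exact (ha y hy).symm
    · exact ha x hx
    · exact hS.1 x hx y hy
  have hB : ∀ x ∈ B, ∀ y ∈ B, x * y = y * x := fun x hx y hy =>
    congrArg Subtype.val ((Algebra.isMulCommutative_adjoin k hcomm).is_comm.comm
      (⟨x, hx⟩ : B) ⟨y, hy⟩)
  exact hS.2 hB (fun s hs => Algebra.subset_adjoin (Set.mem_insert_of_mem a hs))
    (Algebra.subset_adjoin (Set.mem_insert a _))

theorem theorem3p7 {G : Type v} [Group G] [Finite G] {R : Type u} [CommRing R]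
    (α : UnitalPartialAction G R) (hα : α.IsPartialGalois)
    {A : Type u} [Ring A] [Algebra α.invariants A] [IsAzumaya α.invariants A]
    (ι : R →ₐ[α.invariants] A) (hι : Function.Injective ι)
    (hmax : Maximal (fun B : Subalgebra α.invariants A => ∀ x ∈ B, ∀ y ∈ B, x * y = y * x)
      ι.range) :
    α.IsOneCocycle (α.fA (ι : R →+* A)) ∧
    (∀ g, BimodClass.mk (α.gammaBimod (ι : R →+* A) g) = α.fA (ι : R →+* A) g * α.theta g) ∧
    (∀ g, BimodClass.mk (α.gammaBimod (ι : R →+* A) g) ∈ BimodClass.PicSOver α.invariants) ∧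
    IsUnitalPartialRep α.idem (α.gammaBimod (ι : R →+* A)) ∧
    IsFactorSet α.idem (α.gammaBimod (ι : R →+* A)) (α.gammaMul (ι : R →+* A)) ∧
    CrossedProduct.AlgIso (α.gammaBimod (ι : R →+* A)) (α.gammaMul (ι : R →+* A))
      α.invariants Aᵐᵒᵖ ∧
    α.IsPartialGeneralizedCrossedProduct A := by
  cases nonempty_fintype G
  have hmap : ∀ c : α.invariants, ι (c : R) = algebraMap α.invariants A c := ι.commutes
  have hc : ∀ c ∈ α.invariants, ∀ a, ι c * a = a * ι c := fun c hc a => by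
    rw [hmap ⟨c, hc⟩, Algebra.commutes]
  have hcent : ∀ a, (∀ r, ι r * a = a * ι r) → ∃ r, ι r = a := fun a ha =>
    AlgHom.mem_range ι |>.1 <| Subalgebra.mem_of_maximal_commutative hmax <| by
      rintro _ ⟨r, rfl⟩
      exact ha r
  have hend : ∀ φ : A →+ A, (∀ c ∈ α.invariants, ∀ a, φ (ι c * a) = ι c * φ a) →
      ∃ (n : ℕ) (b d : Fin n → A), ∀ a, φ a = ∑ i, b i * a * d i := fun φ hφ =>
    IsAzumaya.exists_sum_mul_mul (k := α.invariants)
      { φ with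
        map_smul' := fun c a => by
          have := hφ c c.2 a
          rwa [hmap, ← Algebra.smul_def, ← Algebra.smul_def] at this }
  have hstrong : α.IsPartiallyStrong (ι : R →+* A) :=
    UnitalPartialAction.isPartiallyStrong hα hc hι hcent hend
  obtain ⟨p, hp⟩ := UnitalPartialAction.exists_isDecomposition (ι := (ι : R →+* A)) hα hc
  -- The opposite algebra satisfies the same hypotheses.
  let ι' : R →+* Aᵐᵒᵖ := (ι : R →+* A).toOpposite fun r s => by
    change ι r * ι s = ι s * ι r
    rw [← map_mul, ← map_mul, mul_comm]
  have hc' : ∀ c ∈ α.invariants, ∀ a, ι' c * a = a * ι' c := fun c hc'' a =>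
    unop_injective (hc c hc'' a.unop).symm
  have hstrong' : α.IsPartiallyStrong ι' := by
    refine UnitalPartialAction.isPartiallyStrong hα hc' (fun r s hrs => hι (op_injective hrs))
      (fun a ha => ?_) fun φ hφ => ?_
    · obtain ⟨r, hr⟩ := hcent a.unop fun r => (congrArg unop (ha r)).symm
      exact ⟨r, unop_injective hr⟩
    · obtain ⟨n, b, d, hbd⟩ := hend
        (opAddEquiv.symm.toAddMonoidHom.comp (φ.comp opAddEquiv.toAddMonoidHom)) fun c hc'' a => by
          have h1 : op (ι c * a) = ι' c * op a := (congrArg op (hc c hc'' a)).trans (op_mul _ _)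
          change unop (φ (op (ι c * a))) = ι c * unop (φ (op a))
          rw [h1, hφ c hc'', hc' c hc'']
          rfl
      refine ⟨n, fun i => op (d i), fun i => op (b i), fun a => unop_injective ?_⟩
      refine (hbd a.unop).trans ?_
      rw [Finset.unop_sum]
      simp only [unop_mul, unop_op, mul_assoc]
  obtain ⟨p', hp'⟩ := UnitalPartialAction.exists_isDecomposition (ι := ι') hα hc'
  refine ⟨hstrong.isOneCocycle,
    fun g => (BimodClass.mk_eq_mk (UnitalPartialAction.cBimod_tensor_thetaBimod_iso g)).symm,
    fun g => ⟨_, hstrong.gammaBimod_isPartiallyInvertible g, fun c hc'' a =>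
      Subtype.ext (hc c hc'' a.1).symm, rfl⟩,
    hstrong.isUnitalPartialRep, hstrong.isFactorSet,
    hp.algIso opAddEquiv (fun a b => rfl) (fun c a => ?_),
    α.fA ι', α.gammaBimod ι', α.gammaMul ι', hstrong'.isOneCocycle,
    fun g => (BimodClass.mk_eq_mk (UnitalPartialAction.cBimod_tensor_thetaBimod_iso g)).symm,
    hstrong'.isUnitalPartialRep, hstrong'.isFactorSet,
    hp'.algIso opAddEquiv.symm (fun a b => rfl) (fun c a => ?_)⟩
  · change op (a * ι c) = c • op a
    rw [← op_smul, Algebra.smul_def, ← hmap, hc c c.2]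
  · change ι c * a.unop = c • a.unop
    rw [Algebra.smul_def, hmap]
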